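/- Let $G=(V,A)$ be a finite directed acyclic graph, whose vertices are called items. An item $v$ is \emph{dominated} by an item $u$ if $G$ has a directed path (possibly of length $0$) from $u$ to $v$. An \emph{allocation} $\pi$ to $k$ agents assigns pairwise disjoint sets $\pi(1),\dots,\pi(k)\subseteq V$ to the agents (not every item has to be allocated), and the \emph{dissatisfaction} of agent $i$ is the number of items that are not dominated by any item of $\pi(i)$. The decision problem \textsc{CG Min-Max Dissatisfaction} takes as input a number $k$ of agents, a finite directed acyclic graph $G$ (given by its adjacency matrix) and an integer $\delta$ (in binary), and asks whether there is an allocation under which every agent has dissatisfaction at most $\delta$. A set $X\subseteq V$ is a \emph{module} of $G$ if all $x,y\in X$ have the same in-neighbours in $V\setminus X$ and the same out-neighbours in $V\setminus X$. A nonempty module $X$ is a \emph{path module} if the induced subgraph $G[X]$ is a directed path, and an \emph{independent-set module} if $G[X]$ has no arcs. Let $d=d(G)$ be the minimum number of parts in a partition of $V$ into path modules and independent-set modules. \textbf{Theorem.} \textsc{CG Min-Max Dissatisfaction} is fixed-parameter tractable with respect to $k+d$: there are an algorithm, a computable function $f:\mathbb N\to\mathbb N$ and a constant $c$ such that the algorithm,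 given only the instance $(k,G,\delta)$, decides it in at most $f(k+d(G))\cdot |(k,G,\delta)|^{c}$ steps, where $|(k,G,\delta)|$ is the size of the input in bits. (The algorithm is a program of a random access machine on natural numbers with unit-cost addition, truncated subtraction, indirect addressing and tests for zero.) -/

import Mathlib

/-! ## Preference graphs, allocations and dissatisfaction -/

namespace CGMinMax

/-- There is a directed walk (equivalently, a directed path), possibly of length `0`,
from `u` to `v`; that is, item `v` is dominated by item `u`. -/
def Dominates {V : Type*} (G : Digraph V) (u v : V) : Prop :=
  Relation.ReflTransGen G.Adj u v

/-- There is no closed directed walk of positive length (equivalently, no directed cycle).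
In particular there are no loops. -/
def Acyclic {V : Type*} (G : Digraph V) : Prop :=
  ∀ v, ¬ Relation.TransGen G.Adj v v

/-- An allocation of items to `k` agents: pairwise disjoint sets of items. Items may remain
unallocated. -/
def IsAllocation {V : Type*} {k : ℕ} (π : Fin k → Finset V) : Prop :=
  ∀ i j, i ≠ j → Disjoint (π i) (π j)

open Classical in
/-- The dissatisfaction of an agent that receives the set `S`: the number of items that are not
dominated by any item of `S`. -/
noncomputable def dissatisfaction {V : Type*} [Fintype V] (G : Digraph V) (S : Finset V) : ℕ :=
  (Finset.univ.filter fun v : V => ∀ u ∈ S, ¬ Dominates G u v).card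

/-- An instance of the problem: a number of agents, a directed acyclic graph on the items
`0, …, numItems - 1`, and an integer threshold. -/
structure Instance where
  numAgents : ℕ
  numItems : ℕ
  graph : Digraph (Fin numItems)
  acyclic : Acyclic graph
  threshold : ℤ

/-- The question of CG Min-Max Dissatisfaction: is there an allocation such that every agent has
dissatisfaction at most the threshold? -/
def Instance.IsYes (I : Instance) : Prop :=
  ∃ π : Fin I.numAgents → Finset (Fin I.numItems),
    IsAllocation π ∧ ∀ i, (dissatisfaction I.graph (π i) : ℤ) ≤ I.threshold

/-! ## Partitions into path modules and independent-set modules -/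

/-- `X` is a module: all vertices of `X` have the same in-neighbours and the same out-neighbours
outside `X`. -/
def IsModule {V : Type*} (G : Digraph V) (X : Finset V) : Prop :=
  ∀ x ∈ X, ∀ y ∈ X,
    ({u | G.Adj u x} \ (X : Set V) = {u | G.Adj u y} \ (X : Set V)) ∧
    ({u | G.Adj x u} \ (X : Set V) = {u | G.Adj y u} \ (X : Set V))

/-- No arc joins two vertices of `X`. -/
def IsIndependent {V : Type*} (G : Digraph V) (X : Finset V) : Prop :=
  ∀ x ∈ X, ∀ y ∈ X, ¬ G.Adj x y

/-- The subgraph induced by `X` is a directed path `p 0 → p 1 → ⋯ → p m`, with no other arcs. -/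
def InducesPath {V : Type*} (G : Digraph V) (X : Finset V) : Prop :=
  ∃ (m : ℕ) (p : Fin (m + 1) → V), Function.Injective p ∧ Set.range p = (X : Set V) ∧
    ∀ i j, G.Adj (p i) (p j) ↔ (i : ℕ) + 1 = (j : ℕ)

/-- A partition of the vertex set (into nonempty parts) each of whose parts is a path module or
an independent-set module. -/
def IsPathIndepPartition {V : Type*} [Fintype V] [DecidableEq V] (G : Digraph V)
    (P : Finpartition (Finset.univ : Finset V)) : Prop :=
  ∀ X ∈ P.parts, IsModule G X ∧ (InducesPath G X ∨ IsIndependent G X)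

/-- The minimum number of path modules and independent-set modules partitioning the vertex set. -/
noncomputable def pathIndepNumber {V : Type*} [Fintype V] [DecidableEq V] (G : Digraph V) : ℕ :=
  sInf {d : ℕ | ∃ P : Finpartition (Finset.univ : Finset V),
    IsPathIndepPartition G P ∧ P.parts.card = d}

/-- In an acyclic graph the minimum is attained (the partition into singletons qualifies). -/
theorem pathIndepNumber_isLeast {V : Type*} [Fintype V] [DecidableEq V] (G : Digraph V)
    (hG : Acyclic G) :
    IsLeast {d : ℕ | ∃ P : Finpartition (Finset.univ : Finset V),
      IsPathIndepPartition G P ∧ P.parts.card = d} (pathIndepNumber G) := by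
  refine ⟨Nat.sInf_mem ⟨_, ⊥, ?_, rfl⟩, fun d hd => Nat.sInf_le hd⟩
  intro X hX
  rw [Finpartition.mem_bot_iff] at hX
  obtain ⟨a, -, rfl⟩ := hX
  refine ⟨?_, Or.inr ?_⟩
  · intro x hx y hy
    rw [Finset.mem_singleton] at hx hy
    subst hx
    subst hy
    exact ⟨rfl, rfl⟩
  · intro x hx y hy h
    rw [Finset.mem_singleton] at hx hy
    subst hx
    subst hy
    exact hG _ (Relation.TransGen.single h)

/-- The parameter `k + d`. -/
noncomputable def Instance.parameter (I : Instance) : ℕ :=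
  I.numAgents + pathIndepNumber I.graph

open Classical in
/-- The instance as a sequence of natural numbers: number of agents, number of items, sign and
absolute value of the threshold, and the `0`-`1` adjacency matrix row by row. -/
noncomputable def Instance.encode (I : Instance) : List ℕ :=
  [I.numAgents, I.numItems, if I.threshold < 0 then 1 else 0, I.threshold.natAbs] ++
    (List.finRange I.numItems).flatMap fun u =>
      (List.finRange I.numItems).map fun v => if I.graph.Adj u v then 1 else 0

end CGMinMax

/-! ## Random access machines and fixed-parameter tractability -/

namespace RAM

/-- The state of the machine: registers, and infinite arrays of cells. All hold natural numbers.
A program names only finitely many registers and arrays. -/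
structure State where
  reg : ℕ → ℕ
  arr : ℕ → ℕ → ℕ

/-- Structured programs. Register and array names are literals of the program; indirect addressing
happens only through the index registers of `load` and `store`. There is no multiplication, so
in `t` steps numbers grow by at most `t` bits (up to the constants of the program), and unit
cost is polynomially related to Turing machine time. -/
inductive Prog where
  /-- do nothing -/
  | skip : Prog
  /-- `r := c` -/
  | const (r c : ℕ) : Prog
  /-- `r := a + b` -/
  | add (r a b : ℕ) : Prog
  /-- `r := a - b`, truncated at `0` -/
  | sub (r a b : ℕ) : Prog
  /-- `r := A[i]` -/
  | load (r A i : ℕ) : Prog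
  /-- `A[i] := r` -/
  | store (A i r : ℕ) : Prog
  /-- first `p`, then `q` -/
  | seq (p q : Prog) : Prog
  /-- if `r ≠ 0` then `p` else `q` -/
  | ite (r : ℕ) (p q : Prog) : Prog
  /-- while `r ≠ 0` do `p` -/
  | loop (r : ℕ) (p : Prog) : Prog

/-- Write `x` into register `r`. -/
def State.setReg (s : State) (r x : ℕ) : State :=
  { s with reg := Function.update s.reg r x }

/-- Write `x` into cell `i` of array `A`. -/
def State.setArr (s : State) (A i x : ℕ) : State :=
  { s with arr := Function.update s.arr A (Function.update (s.arr A) i x) }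

/-- `Runs p s s' t`: started in state `s`, the program `p` halts in state `s'` after exactly `t`
steps. Each elementary instruction and each test of a register counts as one step. -/
inductive Runs : Prog → State → State → ℕ → Prop where
  | skip (s : State) : Runs Prog.skip s s 1
  | const (s : State) (r c : ℕ) : Runs (Prog.const r c) s (s.setReg r c) 1
  | add (s : State) (r a b : ℕ) :
      Runs (Prog.add r a b) s (s.setReg r (s.reg a + s.reg b)) 1
  | sub (s : State) (r a b : ℕ) :
      Runs (Prog.sub r a b) s (s.setReg r (s.reg a - s.reg b)) 1
  | load (s : State) (r A i : ℕ) :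
      Runs (Prog.load r A i) s (s.setReg r (s.arr A (s.reg i))) 1
  | store (s : State) (A i r : ℕ) :
      Runs (Prog.store A i r) s (s.setArr A (s.reg i) (s.reg r)) 1
  | seq {p q : Prog} {s₁ s₂ s₃ : State} {t₁ t₂ : ℕ} :
      Runs p s₁ s₂ t₁ → Runs q s₂ s₃ t₂ → Runs (Prog.seq p q) s₁ s₃ (t₁ + t₂)
  | ite_true {r : ℕ} {p q : Prog} {s s' : State} {t : ℕ} :
      s.reg r ≠ 0 → Runs p s s' t → Runs (Prog.ite r p q) s s' (t + 1)
  | ite_false {r : ℕ} {p q : Prog} {s s' : State} {t : ℕ} :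
      s.reg r = 0 → Runs q s s' t → Runs (Prog.ite r p q) s s' (t + 1)
  | loop_done {r : ℕ} {p : Prog} {s : State} :
      s.reg r = 0 → Runs (Prog.loop r p) s s 1
  | loop_step {r : ℕ} {p : Prog} {s₁ s₂ s₃ : State} {t₁ t₂ : ℕ} :
      s₁.reg r ≠ 0 → Runs p s₁ s₂ t₁ → Runs (Prog.loop r p) s₂ s₃ t₂ →
      Runs (Prog.loop r p) s₁ s₃ (t₁ + t₂ + 1)

/-- The machine is deterministic: final state and number of steps are determined by the program
and the initial state. -/
theorem Runs.deterministic {p : Prog} {s s₁ s₂ : State} {t₁ t₂ : ℕ}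
    (h₁ : Runs p s s₁ t₁) (h₂ : Runs p s s₂ t₂) : s₁ = s₂ ∧ t₁ = t₂ := by
  induction h₁ generalizing s₂ t₂ with
  | seq _ _ ihp ihq =>
    cases h₂ with
    | seq hp hq =>
      obtain ⟨rfl, rfl⟩ := ihp hp
      obtain ⟨rfl, rfl⟩ := ihq hq
      exact ⟨rfl, rfl⟩
  | ite_true hr _ ih =>
    cases h₂ with
    | ite_true _ h => obtain ⟨rfl, rfl⟩ := ih h; exact ⟨rfl, rfl⟩
    | ite_false h0 _ => exact absurd h0 hr
  | ite_false hr _ ih =>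
    cases h₂ with
    | ite_true h0 _ => exact absurd hr h0
    | ite_false _ h => obtain ⟨rfl, rfl⟩ := ih h; exact ⟨rfl, rfl⟩
  | loop_done hr =>
    cases h₂ with
    | loop_done _ => exact ⟨rfl, rfl⟩
    | loop_step h0 _ _ => exact absurd hr h0
  | loop_step hr _ _ ihp ihq =>
    cases h₂ with
    | loop_done h0 => exact absurd h0 hr
    | loop_step _ hp hq =>
      obtain ⟨rfl, rfl⟩ := ihp hp
      obtain ⟨rfl, rfl⟩ := ihq hq
      exact ⟨rfl, rfl⟩
  | _ => cases h₂; exact ⟨rfl, rfl⟩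

/-- The initial state on input `w`: array `0` holds `w`, register `0` holds its length, and
everything else is `0`. -/
def State.init (w : List ℕ) : State where
  reg := fun r => if r = 0 then w.length else 0
  arr := fun A i => if A = 0 then w.getD i 0 else 0

/-- The size of an input: the total length of its entries in binary, with one separator for each
entry. -/
def inputSize (w : List ℕ) : ℕ :=
  (w.map fun x => Nat.size x + 1).sum

/-- The decision problem with instances `α`, encoding `enc` and question `yes` is fixed-parameter
tractable with respect to the parameter `κ`: a single program decides every instance `x`
(register `0` finally holds `1` if and only if `x` is a yes-instance) in at most
`f (κ x) * |x| ^ c` steps, where `f` is a computable function and `c` a constant. The program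
receives only the instance, not the value of the parameter. -/
def FixedParameterTractable {α : Type*} (enc : α → List ℕ) (yes : α → Prop) (κ : α → ℕ) : Prop :=
  ∃ (p : Prog) (f : ℕ → ℕ) (c : ℕ), Computable f ∧
    ∀ x : α, ∃ (s : State) (t : ℕ),
      Runs p (State.init (enc x)) s t ∧
      t ≤ f (κ x) * inputSize (enc x) ^ c ∧
      (s.reg 0 = 1 ↔ yes x)

end RAM

/-! ### Machine states under writes to registers and cells -/

namespace RAM

/-! The algorithm uses a kernel that is defined from `G` and `k` alone, so no partition into modules
is ever computed. Call `u` and `v` twins if they are incomparable and have the same strict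
dominators and the same strictly dominated items. The relation `Precedes G u v` says that `u` may
replace `v` in a bundle: either they are twins and `u` has the smaller index, or `u` strictly
dominates `v` and is comparable with every dominator of `v`. Kernel items are preceded by fewer than
`k` items. Two items of a path module are always related by `Precedes`
(`InducesPath.precedes_total`), and so are two items of an independent-set module, which are twins
(`IsIndependent.isTwin`). Hence every part contains at most `k` kernel items, and there are at most
`k * d` in all (`card_kernel_le`).

An exchange argument moves the essential part of an allocation into the kernel. In a bundle, an item
dominated by another is useless, and a twin of another contributes nothing but itself; such a twin
is set aside as an extra item. After this cleaning, a bundle contains at most one predecessor of any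
given item `v`, and the bundle of `v` contains none. So if `v` is allocated and not in the kernel,
one of its at least `k` predecessors lies in no bundle, and it can be exchanged with `v`. Every such
move lowers a total weight (`IsCertificate.exists_lt`), so the process ends with all bundles inside
the kernel (`IsCertificate.exists_kernel`).

Once the bundles are fixed, it remains to hand out unowned items, each counted only for itself, so
that each agent gets as many of its undominated items as it still needs. Hall's theorem turns this
into one inequality for each set of agents (`exists_extra_iff`), and `exists_allocation_iff`
combines the two steps.

The machine computes domination by Warshall's algorithm, enumerates the at most `(k + 1) ^ (k * d)`
ownership functions on the kernel and checks all Hall inequalities. The program is written in a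
language of bounded loops whose compiled code runs in time polynomial in the largest loop bound
(`Stmt.runs_compile`); the exponential dependence on the parameter enters only through two loop
bounds. -/

@[simp] theorem State.setReg_reg_self (s : State) (r x : ℕ) : (s.setReg r x).reg r = x := by
  simp [State.setReg]

theorem State.setReg_reg_of_ne (s : State) {r r' : ℕ} (x : ℕ) (h : r' ≠ r) :
    (s.setReg r x).reg r' = s.reg r' := by
  simp [State.setReg, h]

theorem State.setReg_reg (s : State) (r r' x : ℕ) :
    (s.setReg r x).reg r' = if r' = r then x else s.reg r' := by
  simp [State.setReg, Function.update_apply]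

@[simp] theorem State.setReg_arr (s : State) (r x : ℕ) : (s.setReg r x).arr = s.arr := rfl

@[simp] theorem State.setArr_reg (s : State) (A i x : ℕ) : (s.setArr A i x).reg = s.reg := rfl

theorem State.setArr_arr (s : State) (A i x A' i' : ℕ) :
    (s.setArr A i x).arr A' i' = if A' = A ∧ i' = i then x else s.arr A' i' := by
  unfold State.setArr
  by_cases hA : A' = A
  · subst hA; simp [Function.update_apply]
  · simp [hA]

/-! ## An expression language with bounded summation, and its compilation -/

/-- Expressions over registers and arrays. `sum x N e` is the sum of `e` over all values of the
register `x` below the content of the register `N`. -/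
inductive Ex where
  | var (r : ℕ) : Ex
  | const (c : ℕ) : Ex
  | add (a b : Ex) : Ex
  | sub (a b : Ex) : Ex
  | get (A : ℕ) (e : Ex) : Ex
  | ite (c a b : Ex) : Ex
  | sum (x N : ℕ) (e : Ex) : Ex

/-- The value of an expression. -/
def Ex.eval : Ex → State → ℕ
  | .var r, s => s.reg r
  | .const c, _ => c
  | .add a b, s => a.eval s + b.eval s
  | .sub a b, s => a.eval s - b.eval s
  | .get A e, s => s.arr A (e.eval s)
  | .ite c a b, s => if c.eval s ≠ 0 then a.eval s else b.eval s
  | .sum x N e, s => ∑ i ∈ Finset.range (s.reg N), e.eval (s.setReg x i)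

/-- The registers that bound the summations in an expression. -/
def Ex.bounds : Ex → List ℕ
  | .var _ => []
  | .const _ => []
  | .add a b => a.bounds ++ b.bounds
  | .sub a b => a.bounds ++ b.bounds
  | .get _ e => e.bounds
  | .ite c a b => c.bounds ++ (a.bounds ++ b.bounds)
  | .sum _ N e => N :: e.bounds

/-- Copy register `a` to a register `r ≠ a`. -/
def Prog.copy (r a : ℕ) : Prog := .seq (.const r 0) (.add r r a)

/-- Machine code which runs `body` for all values of the register `2 * x` below the content
of the register `2 * N` and finally restores the register `2 * x`. -/
def Prog.repeat (d x N : ℕ) (body : Prog) : Prog :=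
  .seq (.copy (2 * d + 1) (2 * x)) <|
  .seq (.copy (2 * (d + 1) + 1) (2 * N)) <|
  .seq (.const (2 * x) 0) <|
  .seq (.loop (2 * (d + 1) + 1) <|
    .seq body <|
    .seq (.const (2 * (d + 2) + 1) 1) <|
    .seq (.add (2 * x) (2 * x) (2 * (d + 2) + 1)) <|
    (.sub (2 * (d + 1) + 1) (2 * (d + 1) + 1) (2 * (d + 2) + 1))) <|
  (.copy (2 * x) (2 * d + 1))

/-- Machine code that evaluates an expression into the register `2 * d + 1`. The register `r` of
the expression is the register `2 * r` of the machine. -/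
def Ex.compile : Ex → ℕ → Prog
  | .var r, d => .copy (2 * d + 1) (2 * r)
  | .const c, d => .const (2 * d + 1) c
  | .add a b, d => .seq (a.compile d) (.seq (b.compile (d + 1))
      (.add (2 * d + 1) (2 * d + 1) (2 * (d + 1) + 1)))
  | .sub a b, d => .seq (a.compile d) (.seq (b.compile (d + 1))
      (.sub (2 * d + 1) (2 * d + 1) (2 * (d + 1) + 1)))
  | .get A e, d => .seq (e.compile d) (.load (2 * d + 1) A (2 * d + 1))
  | .ite c a b, d => .seq (c.compile d) (.ite (2 * d + 1) (a.compile d) (b.compile d))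
  | .sum x N e, d => .seq (.const (2 * d + 1) 0) (.repeat (d + 1) x N
      (.seq (e.compile (d + 3)) (.add (2 * d + 1) (2 * d + 1) (2 * (d + 3) + 1))))

/-- The machine state `t` represents the state `s` in its even registers. -/
def Represents (t s : State) : Prop :=
  (∀ r, t.reg (2 * r) = s.reg r) ∧ t.arr = s.arr

/-- The odd registers with index below `d` agree. -/
def SameScratch (d : ℕ) (t t' : State) : Prop :=
  ∀ j < d, t'.reg (2 * j + 1) = t.reg (2 * j + 1)

theorem SameScratch.trans {d : ℕ} {t₁ t₂ t₃ : State} (h : SameScratch d t₁ t₂)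
    (h' : SameScratch d t₂ t₃) : SameScratch d t₁ t₃ :=
  fun j hj => (h' j hj).trans (h j hj)

theorem SameScratch.mono {d d' : ℕ} {t₁ t₂ : State} (h : SameScratch d t₁ t₂) (hd : d' ≤ d) :
    SameScratch d' t₁ t₂ :=
  fun j hj => h j (hj.trans_le hd)

theorem sameScratch_setReg_odd {d e : ℕ} (t : State) (x : ℕ) (h : d ≤ e) :
    SameScratch d t (t.setReg (2 * e + 1) x) :=
  fun j hj => State.setReg_reg_of_ne _ _ (by omega)

theorem sameScratch_setReg_even (d e : ℕ) (t : State) (x : ℕ) :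
    SameScratch d t (t.setReg (2 * e) x) :=
  fun j hj => State.setReg_reg_of_ne _ _ (by omega)

theorem Represents.setReg_odd {t s : State} (h : Represents t s) (e x : ℕ) :
    Represents (t.setReg (2 * e + 1) x) s :=
  ⟨fun r => by rw [State.setReg_reg_of_ne _ _ (by omega), h.1], h.2⟩

theorem Represents.setReg_even {t s : State} (h : Represents t s) (e x : ℕ) :
    Represents (t.setReg (2 * e) x) (s.setReg e x) := by
  refine ⟨fun r => ?_, h.2⟩
  by_cases hr : r = e
  · subst hr; simp
  · rw [State.setReg_reg_of_ne _ _ (by omega), State.setReg_reg_of_ne _ _ hr, h.1]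

theorem Represents.setArr {t s : State} (h : Represents t s) (A i x : ℕ) :
    Represents (t.setArr A i x) (s.setArr A i x) :=
  ⟨h.1, by simp only [State.setArr, h.2]⟩

theorem Runs.copy (t : State) {r a : ℕ} (h : r ≠ a) :
    Runs (.copy r a) t (t.setReg r (t.reg a)) 2 := by
  have h1 := Runs.seq (Runs.const t r 0) (Runs.add (t.setReg r 0) r r a)
  have h2 : (t.setReg r 0).setReg r ((t.setReg r 0).reg r + (t.setReg r 0).reg a) =
      t.setReg r (t.reg a) := by
    rw [State.setReg_reg_of_ne _ _ h.symm]
    simp [State.setReg]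
  rw [h2] at h1
  exact h1

theorem State.setReg_setReg (s : State) (r x y : ℕ) :
    (s.setReg r x).setReg r y = s.setReg r y := by
  simp [State.setReg]

theorem State.setReg_self (s : State) (r : ℕ) : s.setReg r (s.reg r) = s := by
  simp [State.setReg]

/-- The states that a loop over the register `x` passes through. -/
def iterState (x : ℕ) (F : State → State) (s : State) : ℕ → State
  | 0 => s
  | i + 1 => F ((iterState x F s i).setReg x i)

/-- The loop behind `Prog.repeat`, with an invariant `Q` and a bound `T` for one pass. -/
theorem Runs.repeat {d x N : ℕ} {body : Prog} {s t : State} {F : State → State} {T : ℕ}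
    {Q : ℕ → State → Prop}
    (h : Represents t s) (hF : ∀ s' : State, (F s').reg x = s'.reg x)
    (hQ0 : ∀ t', Represents t' (s.setReg x 0) → SameScratch d t t' → Q 0 t')
    (hQ : ∀ i t' t'', Q i t' → SameScratch d t' t'' → Q i t'')
    (hbody : ∀ i < s.reg N, ∀ t', Represents t' ((iterState x F s i).setReg x i) →
      Q i t' → ∃ t'' n, Runs body t' t'' n ∧
        Represents t'' (iterState x F s (i + 1)) ∧
        t''.reg (2 * d + 1) = t'.reg (2 * d + 1) ∧
        t''.reg (2 * (d + 1) + 1) = t'.reg (2 * (d + 1) + 1) ∧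
        Q (i + 1) t'' ∧ n ≤ T) :
    ∃ t' n, Runs (.repeat d x N body) t t' n ∧
      Represents t' ((iterState x F s (s.reg N)).setReg x (s.reg x)) ∧
      Q (s.reg N) t' ∧ n ≤ s.reg N * (T + 4) + 8 := by
  -- Induction on the number `m` of remaining passes, which is what the countdown register holds.
  -- The bound is copied once at the start, so only its initial value matters.
  have key : ∀ m i, i + m = s.reg N → ∀ t',
      Represents t' ((iterState x F s i).setReg x i) → t'.reg (2 * d + 1) = s.reg x →
      t'.reg (2 * (d + 1) + 1) = m → Q i t' →
      ∃ t'' n, Runs (.loop (2 * (d + 1) + 1) <|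
        .seq body <|
        .seq (.const (2 * (d + 2) + 1) 1) <|
        .seq (.add (2 * x) (2 * x) (2 * (d + 2) + 1)) <|
        (.sub (2 * (d + 1) + 1) (2 * (d + 1) + 1) (2 * (d + 2) + 1))) t' t'' n ∧
        Represents t'' ((iterState x F s (s.reg N)).setReg x (s.reg N)) ∧
        t''.reg (2 * d + 1) = s.reg x ∧ Q (s.reg N) t'' ∧ n ≤ m * (T + 4) + 1 := by
    intro m
    induction m with
    | zero =>
      intro i hi t' ht' hx hm hq
      obtain rfl : i = s.reg N := by omega
      exact ⟨t', 1, Runs.loop_done hm, ht', hx, hq, by omega⟩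
    | succ m ih =>
      intro i hi t' ht' hx hm hq
      obtain ⟨t₁, n₁, hr₁, hrep₁, hs₁, hc₁, hq₁, hn₁⟩ := hbody i (by omega) t' ht' hq
      have hxi : t₁.reg (2 * x) = i := by
        rw [hrep₁.1, iterState, hF, State.setReg_reg_self]
      set t₂ := t₁.setReg (2 * (d + 2) + 1) 1 with ht₂
      set t₃ := t₂.setReg (2 * x) (t₂.reg (2 * x) + t₂.reg (2 * (d + 2) + 1)) with ht₃
      set t₄ := t₃.setReg (2 * (d + 1) + 1)
        (t₃.reg (2 * (d + 1) + 1) - t₃.reg (2 * (d + 2) + 1)) with ht₄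
      have e2 : t₃ = t₂.setReg (2 * x) (i + 1) := by
        rw [ht₃, ht₂]
        rw [State.setReg_reg_self, State.setReg_reg_of_ne _ _ (by omega), hxi]
      have e3 : t₃.reg (2 * (d + 1) + 1) - t₃.reg (2 * (d + 2) + 1) = m := by
        rw [e2, ht₂]
        simp only [State.setReg_reg]
        split_ifs <;> omega
      have e4 : t₄ = ((t₁.setReg (2 * (d + 2) + 1) 1).setReg (2 * x) (i + 1)).setReg
          (2 * (d + 1) + 1) m := by
        rw [ht₄, e3, e2, ht₂]
      have hrep₄ : Represents t₄ ((iterState x F s (i + 1)).setReg x (i + 1)) := by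
        rw [e4]
        exact ((hrep₁.setReg_odd _ _).setReg_even _ _).setReg_odd _ _
      have hsc : SameScratch d t₁ t₄ := by
        rw [e4]
        exact ((sameScratch_setReg_odd _ _ (by omega)).trans
          (sameScratch_setReg_even _ _ _ _)).trans (sameScratch_setReg_odd _ _ (by omega))
      obtain ⟨t₅, n₅, hr₅, hrep₅, hs₅, hq₅, hn₅⟩ := ih (i + 1) (by omega) t₄ hrep₄
        (by
          rw [e4, State.setReg_reg_of_ne _ _ (by omega), State.setReg_reg_of_ne _ _ (by omega),
            State.setReg_reg_of_ne _ _ (by omega), hs₁, hx])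
        (by rw [e4, State.setReg_reg_self]) (hQ _ _ _ hq₁ hsc)
      refine ⟨t₅, _, Runs.loop_step (by omega) (Runs.seq hr₁ (Runs.seq (Runs.const _ _ _)
        (Runs.seq (Runs.add _ _ _ _) (Runs.sub _ _ _ _)))) hr₅, hrep₅, hs₅, hq₅, ?_⟩
      have : (m + 1) * (T + 4) = m * (T + 4) + (T + 4) := by ring
      omega
  set t₁ := t.setReg (2 * d + 1) (t.reg (2 * x)) with ht₁
  set t₂ := t₁.setReg (2 * (d + 1) + 1) (t₁.reg (2 * N)) with ht₂
  set t₃ := t₂.setReg (2 * x) 0 with ht₃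
  have hrep₃ : Represents t₃ (s.setReg x 0) :=
    ((h.setReg_odd _ _).setReg_odd _ _).setReg_even _ _
  have hsc : SameScratch d t t₃ :=
    ((sameScratch_setReg_odd _ _ (by omega)).trans
      (sameScratch_setReg_odd _ _ (by omega))).trans (sameScratch_setReg_even _ _ _ _)
  obtain ⟨t₄, n, hr, hrep, hs, hq, hn⟩ := key (s.reg N) 0 (by omega) t₃ hrep₃
    (by
      rw [ht₃, State.setReg_reg_of_ne _ _ (by omega), ht₂, State.setReg_reg_of_ne _ _ (by omega),
        ht₁, State.setReg_reg_self, h.1])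
    (by
      rw [ht₃, State.setReg_reg_of_ne _ _ (by omega), ht₂, State.setReg_reg_self, ht₁,
        State.setReg_reg_of_ne _ _ (by omega), h.1])
    (hQ0 _ hrep₃ hsc)
  refine ⟨t₄.setReg (2 * x) (t₄.reg (2 * d + 1)), _, Runs.seq (Runs.copy _ (by omega))
    (Runs.seq (Runs.copy _ (by omega)) (Runs.seq (Runs.const _ _ _)
      (Runs.seq hr (Runs.copy _ (by omega))))), ?_,
    hQ _ _ _ hq (sameScratch_setReg_even _ _ _ _), by omega⟩
  have := hrep.setReg_even x (t₄.reg (2 * d + 1))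
  rw [State.setReg_setReg] at this
  simpa only [hs] using this

/-- The base is at least 2, so one extra exponent absorbs a sum of two powers. This keeps every time
bound in the single form `(M + 2) ^ D` with `D` depending only on the program. -/
theorem add_le_pow_max_succ {M D₁ D₂ a b : ℕ} (ha : a ≤ (M + 2) ^ D₁) (hb : b ≤ (M + 2) ^ D₂) :
    a + b ≤ (M + 2) ^ (max D₁ D₂ + 1) := by
  have h1 : a ≤ (M + 2) ^ (max D₁ D₂) :=
    ha.trans (Nat.pow_le_pow_right (by omega) (le_max_left _ _))
  have h2 : b ≤ (M + 2) ^ (max D₁ D₂) :=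
    hb.trans (Nat.pow_le_pow_right (by omega) (le_max_right _ _))
  rw [pow_succ]
  nlinarith [Nat.zero_le (M * (M + 2) ^ (max D₁ D₂))]

/-- At most `M` passes and the constant overhead together cost five more exponents, because `6 * M +
9 ≤ (M + 2) ^ 5`; the 6 comes from `T + 5 ≤ 6 * (M + 2) ^ D`. -/
theorem loop_time_le {M D N T n : ℕ} (hN : N ≤ M) (hT : T ≤ (M + 2) ^ D)
    (hn : n ≤ N * (T + 5) + 9) : n ≤ (M + 2) ^ (D + 5) := by
  have h1 : 1 ≤ (M + 2) ^ D := Nat.one_le_pow _ _ (by omega)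
  have h2 : T + 5 ≤ 6 * (M + 2) ^ D := by omega
  have h3 : N * (T + 5) ≤ M * (6 * (M + 2) ^ D) := Nat.mul_le_mul hN h2
  have h4 : (M + 2) ^ (D + 5) = (M + 2) ^ D * (M + 2) ^ 5 := pow_add _ _ _
  have h5 : 6 * M + 9 ≤ (M + 2) ^ 5 := by
    have : 16 ≤ (M + 2) ^ 4 := by
      calc 16 = 2 ^ 4 := by norm_num
        _ ≤ (M + 2) ^ 4 := Nat.pow_le_pow_left (by omega) _
    rw [pow_succ]
    nlinarith
  rw [h4]
  nlinarith [Nat.mul_le_mul_left ((M + 2) ^ D) h5]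

theorem iterState_id (x : ℕ) (s : State) (i : ℕ) (y : ℕ) :
    (iterState x (fun s' => s') s i).setReg x y = s.setReg x y := by
  induction i generalizing y with
  | zero => rfl
  | succ i ih => rw [iterState, State.setReg_setReg, ih]

/-- The compiled expression computes the value, in time polynomial in the loop bounds. -/
theorem Ex.runs_compile (e : Ex) : ∃ D, ∀ (d M : ℕ) (s t : State), Represents t s →
    (∀ r ∈ e.bounds, s.reg r ≤ M) →
    ∃ t' n, Runs (e.compile d) t t' n ∧ Represents t' s ∧ SameScratch d t t' ∧
      t'.reg (2 * d + 1) = e.eval s ∧ n ≤ (M + 2) ^ D := by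
  induction e with
  | var r =>
    refine ⟨1, fun d M s t h _ => ⟨_, _, Runs.copy t (by omega), h.setReg_odd _ _,
      sameScratch_setReg_odd _ _ le_rfl, ?_, by simp⟩⟩
    rw [State.setReg_reg_self, h.1, eval]
  | const c =>
    exact ⟨1, fun d M s t h _ => ⟨_, _, Runs.const t _ _, h.setReg_odd _ _,
      sameScratch_setReg_odd _ _ le_rfl, State.setReg_reg_self _ _ _, by simp⟩⟩
  | add a b iha ihb =>
    obtain ⟨Da, iha⟩ := iha
    obtain ⟨Db, ihb⟩ := ihb
    -- The exponent copies the nesting of `Runs.seq` under `add_le_pow_max_succ`; the `0` belongs to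
    -- the single final instruction.
    refine ⟨max Da (max Db 0 + 1) + 1, fun d M s t h hM => ?_⟩
    simp only [bounds, List.mem_append] at hM
    obtain ⟨t₁, n₁, hr₁, hrep₁, hsc₁, hv₁, hn₁⟩ := iha d M s t h fun r hr => hM r (.inl hr)
    obtain ⟨t₂, n₂, hr₂, hrep₂, hsc₂, hv₂, hn₂⟩ := ihb (d + 1) M s t₁ hrep₁
      fun r hr => hM r (.inr hr)
    refine ⟨_, _, Runs.seq hr₁ (Runs.seq hr₂ (Runs.add _ _ _ _)), hrep₂.setReg_odd _ _,
      (hsc₁.trans (hsc₂.mono (by omega))).trans (sameScratch_setReg_odd _ _ le_rfl), ?_,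
      add_le_pow_max_succ hn₁ (add_le_pow_max_succ hn₂ (by simp))⟩
    rw [State.setReg_reg_self, hv₂, hsc₂ d (by omega), hv₁, eval]
  | sub a b iha ihb =>
    obtain ⟨Da, iha⟩ := iha
    obtain ⟨Db, ihb⟩ := ihb
    refine ⟨max Da (max Db 0 + 1) + 1, fun d M s t h hM => ?_⟩
    simp only [bounds, List.mem_append] at hM
    obtain ⟨t₁, n₁, hr₁, hrep₁, hsc₁, hv₁, hn₁⟩ := iha d M s t h fun r hr => hM r (.inl hr)
    obtain ⟨t₂, n₂, hr₂, hrep₂, hsc₂, hv₂, hn₂⟩ := ihb (d + 1) M s t₁ hrep₁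
      fun r hr => hM r (.inr hr)
    refine ⟨_, _, Runs.seq hr₁ (Runs.seq hr₂ (Runs.sub _ _ _ _)), hrep₂.setReg_odd _ _,
      (hsc₁.trans (hsc₂.mono (by omega))).trans (sameScratch_setReg_odd _ _ le_rfl), ?_,
      add_le_pow_max_succ hn₁ (add_le_pow_max_succ hn₂ (by simp))⟩
    rw [State.setReg_reg_self, hv₂, hsc₂ d (by omega), hv₁, eval]
  | get A e ih =>
    obtain ⟨D, ih⟩ := ih
    refine ⟨max D 0 + 1, fun d M s t h hM => ?_⟩
    obtain ⟨t₁, n₁, hr₁, hrep₁, hsc₁, hv₁, hn₁⟩ := ih d M s t h hM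
    refine ⟨_, _, Runs.seq hr₁ (Runs.load _ _ _ _), hrep₁.setReg_odd _ _,
      hsc₁.trans (sameScratch_setReg_odd _ _ le_rfl), ?_, add_le_pow_max_succ hn₁ (by simp)⟩
    rw [State.setReg_reg_self, hv₁, hrep₁.2, eval]
  | ite c a b ihc iha ihb =>
    obtain ⟨Dc, ihc⟩ := ihc
    obtain ⟨Da, iha⟩ := iha
    obtain ⟨Db, ihb⟩ := ihb
    refine ⟨max Dc (max (max Da Db) 0 + 1) + 1, fun d M s t h hM => ?_⟩
    simp only [bounds, List.mem_append] at hM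
    obtain ⟨t₁, n₁, hr₁, hrep₁, hsc₁, hv₁, hn₁⟩ := ihc d M s t h fun r hr => hM r (.inl hr)
    by_cases hc : c.eval s = 0
    · obtain ⟨t₂, n₂, hr₂, hrep₂, hsc₂, hv₂, hn₂⟩ := ihb d M s t₁ hrep₁
        fun r hr => hM r (.inr (.inr hr))
      refine ⟨_, _, Runs.seq hr₁ (Runs.ite_false (by rw [hv₁, hc]) hr₂), hrep₂, hsc₁.trans hsc₂,
        by rw [hv₂, eval, if_neg (by simpa using hc)], add_le_pow_max_succ hn₁
          (add_le_pow_max_succ (hn₂.trans (Nat.pow_le_pow_right (by omega) (le_max_right _ _)))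
          (by simp))⟩
    · obtain ⟨t₂, n₂, hr₂, hrep₂, hsc₂, hv₂, hn₂⟩ := iha d M s t₁ hrep₁
        fun r hr => hM r (.inr (.inl hr))
      refine ⟨_, _, Runs.seq hr₁ (Runs.ite_true (by rw [hv₁]; exact hc) hr₂), hrep₂,
        hsc₁.trans hsc₂, by rw [hv₂, eval, if_pos hc], add_le_pow_max_succ hn₁
          (add_le_pow_max_succ (hn₂.trans (Nat.pow_le_pow_right (by omega) (le_max_left _ _)))
          (by simp))⟩
  | sum x N e ih =>
    obtain ⟨D, ih⟩ := ih
    refine ⟨D + 5, fun d M s t h hM => ?_⟩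
    simp only [bounds, List.mem_cons, forall_eq_or_imp] at hM
    set t₀ := t.setReg (2 * d + 1) 0 with ht₀
    have h₀ : Represents t₀ s := h.setReg_odd _ _
    have hsc₀ : SameScratch d t t₀ := sameScratch_setReg_odd _ _ le_rfl
    -- A summation does not change the represented state, so `F` is the identity. The partial sum
    -- lives in the scratch register `2 * d + 1`, below those of the loop, and is tracked by `Q`.
    obtain ⟨t₁, n₁, hr₁, hrep₁, ⟨hq₁, hq₁'⟩, hn₁⟩ := Runs.repeat (d := d + 1) (x := x) (N := N)
      (body := .seq (e.compile (d + 3)) (.add (2 * d + 1) (2 * d + 1) (2 * (d + 3) + 1)))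
      (F := fun s' => s') (T := (M + 2) ^ D + 1) h₀ (fun _ => rfl)
      (Q := fun i t' => SameScratch d t t' ∧
        t'.reg (2 * d + 1) = ∑ j ∈ Finset.range i, e.eval (s.setReg x j))
      (fun t' _ hsc => ⟨hsc₀.trans (hsc.mono (by omega)), by
        rw [hsc d (by omega), ht₀]; simp⟩)
      (fun i t' t'' hq hsc => ⟨hq.1.trans (hsc.mono (by omega)), by rw [hsc d (by omega), hq.2]⟩)
      (by
        rintro i hi t' hrep ⟨hq, hq'⟩
        rw [iterState_id] at hrep
        obtain ⟨t₂, n₂, hr₂, hrep₂, hsc₂, hv₂, hn₂⟩ := ih (d + 3) M (s.setReg x i) t' hrep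
          (fun r hr => by
            rw [State.setReg_reg]
            split_ifs
            · exact hi.le.trans hM.1
            · exact hM.2 r hr)
        refine ⟨_, _, Runs.seq hr₂ (Runs.add _ _ _ _), ?_, ?_, ?_, ⟨?_, ?_⟩, by omega⟩
        · rw [iterState, iterState_id]
          exact hrep₂.setReg_odd _ _
        · rw [State.setReg_reg_of_ne _ _ (by omega), hsc₂ _ (by omega)]
        · rw [State.setReg_reg_of_ne _ _ (by omega), hsc₂ _ (by omega)]
        · exact (hq.trans (hsc₂.mono (by omega))).trans (sameScratch_setReg_odd _ _ le_rfl)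
        · rw [State.setReg_reg_self, hv₂, hsc₂ d (by omega), hq', Finset.sum_range_succ])
    refine ⟨t₁, _, Runs.seq (Runs.const _ _ _) hr₁, ?_, hq₁, ?_, loop_time_le (N := s.reg N)
      (T := (M + 2) ^ D) hM.1 le_rfl ?_⟩
    · rwa [iterState_id, State.setReg_self] at hrep₁
    · rw [hq₁', eval]
    · have : s.reg N * ((M + 2) ^ D + 1 + 4) = s.reg N * ((M + 2) ^ D + 5) := by ring
      omega

/-! ## Statements with bounded loops -/

/-- Statements: assignments to registers and array cells, composition, and loops over a register
`x` up to the content of the register `N`. -/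
inductive Stmt where
  | assign (r : ℕ) (e : Ex) : Stmt
  | store (A : ℕ) (i e : Ex) : Stmt
  | seq (p q : Stmt) : Stmt
  | loop (x N : ℕ) (p : Stmt) : Stmt

/-- The effect of a statement. -/
def Stmt.exec : Stmt → State → State
  | .assign r e, s => s.setReg r (e.eval s)
  | .store A i e, s => s.setArr A (i.eval s) (e.eval s)
  | .seq p q, s => q.exec (p.exec s)
  | .loop x N p, s => (iterState x p.exec s (s.reg N)).setReg x (s.reg x)

/-- The registers that bound the loops and summations of a statement. -/
def Stmt.bounds : Stmt → List ℕ
  | .assign _ e => e.bounds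
  | .store _ i e => i.bounds ++ e.bounds
  | .seq p q => p.bounds ++ q.bounds
  | .loop _ N p => N :: p.bounds

/-- The registers that a statement assigns. -/
def Stmt.writes : Stmt → List ℕ
  | .assign r _ => [r]
  | .store _ _ _ => []
  | .seq p q => p.writes ++ q.writes
  | .loop _ _ p => p.writes

/-- Loop indices and loop bounds are not assigned. -/
def Stmt.WellFormed : Stmt → Prop
  | .assign _ _ => True
  | .store _ _ _ => True
  | .seq p q => p.WellFormed ∧ q.WellFormed ∧ ∀ r ∈ q.bounds, r ∉ p.writes
  | .loop x _ p => p.WellFormed ∧ x ∉ p.writes ∧ ∀ r ∈ p.bounds, r ∉ p.writes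

/-- Machine code for a statement. -/
def Stmt.compile : Stmt → ℕ → Prog
  | .assign r e, d => .seq (e.compile d) (.copy (2 * r) (2 * d + 1))
  | .store A i e, d => .seq (i.compile d) (.seq (e.compile (d + 1))
      (.store A (2 * d + 1) (2 * (d + 1) + 1)))
  | .seq p q, d => .seq (p.compile d) (q.compile d)
  | .loop x N p, d => .repeat d x N (p.compile (d + 2))

theorem iterState_reg_of_ne {x r : ℕ} {F : State → State} (hF : ∀ s, (F s).reg r = s.reg r)
    (hx : r ≠ x) (s : State) (i : ℕ) : (iterState x F s i).reg r = s.reg r := by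
  induction i with
  | zero => rfl
  | succ i ih => rw [iterState, hF, State.setReg_reg_of_ne _ _ hx, ih]

/-- Together with `WellFormed`, this lets every loop bound inside a statement be estimated by its
value in the state before the statement. -/
theorem Stmt.exec_reg (p : Stmt) {r : ℕ} (hr : r ∉ p.writes) (s : State) :
    (p.exec s).reg r = s.reg r := by
  induction p generalizing s with
  | assign r' e =>
    simp only [writes, List.mem_singleton] at hr
    exact State.setReg_reg_of_ne _ _ hr
  | store A i e => rfl
  | seq p q ihp ihq =>
    simp only [writes, List.mem_append, not_or] at hr
    rw [exec, ihq hr.2, ihp hr.1]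
  | loop x N p ih =>
    rw [exec, State.setReg_reg]
    split_ifs with h
    · rw [h]
    · exact iterState_reg_of_ne (ih hr) h _ _

/-- The compiled statement has the specified effect, in time polynomial in the loop bounds. -/
theorem Stmt.runs_compile (p : Stmt) (hp : p.WellFormed) : ∃ D, ∀ (d M : ℕ) (s t : State),
    Represents t s → (∀ r ∈ p.bounds, s.reg r ≤ M) →
    ∃ t' n, Runs (p.compile d) t t' n ∧ Represents t' (p.exec s) ∧ SameScratch d t t' ∧
      n ≤ (M + 2) ^ D := by
  induction p with
  | assign r e =>
    obtain ⟨D, h⟩ := e.runs_compile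
    refine ⟨max D 1 + 1, fun d M s t ht hM => ?_⟩
    obtain ⟨t₁, n₁, hr₁, hrep₁, hsc₁, hv₁, hn₁⟩ := h d M s t ht hM
    refine ⟨_, _, Runs.seq hr₁ (Runs.copy _ (by omega)), ?_,
      hsc₁.trans (sameScratch_setReg_even _ _ _ _), add_le_pow_max_succ hn₁ (by simp)⟩
    rw [hv₁]
    exact hrep₁.setReg_even _ _
  | store A i e =>
    obtain ⟨D, h⟩ := i.runs_compile
    obtain ⟨D', h'⟩ := e.runs_compile
    refine ⟨max D (max D' 0 + 1) + 1, fun d M s t ht hM => ?_⟩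
    simp only [bounds, List.mem_append] at hM
    obtain ⟨t₁, n₁, hr₁, hrep₁, hsc₁, hv₁, hn₁⟩ := h d M s t ht fun r hr => hM r (.inl hr)
    obtain ⟨t₂, n₂, hr₂, hrep₂, hsc₂, hv₂, hn₂⟩ := h' (d + 1) M s t₁ hrep₁
      fun r hr => hM r (.inr hr)
    refine ⟨_, _, Runs.seq hr₁ (Runs.seq hr₂ (Runs.store _ _ _ _)), ?_,
      hsc₁.trans (hsc₂.mono (by omega)), add_le_pow_max_succ hn₁ (add_le_pow_max_succ hn₂ (by simp))⟩
    rw [hv₂, hsc₂ d (by omega), hv₁]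
    exact hrep₂.setArr _ _ _
  | seq p q ihp ihq =>
    obtain ⟨D, h⟩ := ihp hp.1
    obtain ⟨D', h'⟩ := ihq hp.2.1
    refine ⟨max D D' + 1, fun d M s t ht hM => ?_⟩
    simp only [bounds, List.mem_append] at hM
    obtain ⟨t₁, n₁, hr₁, hrep₁, hsc₁, hn₁⟩ := h d M s t ht fun r hr => hM r (.inl hr)
    obtain ⟨t₂, n₂, hr₂, hrep₂, hsc₂, hn₂⟩ := h' d M _ t₁ hrep₁ fun r hr => by
      rw [exec_reg _ (hp.2.2 r hr)]
      exact hM r (.inr hr)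
    exact ⟨_, _, Runs.seq hr₁ hr₂, hrep₂, hsc₁.trans hsc₂, add_le_pow_max_succ hn₁ hn₂⟩
  | loop x N p ih =>
    obtain ⟨D, ih⟩ := ih hp.1
    refine ⟨D + 5, fun d M s t h hM => ?_⟩
    simp only [bounds, List.mem_cons, forall_eq_or_imp] at hM
    obtain ⟨t₁, n₁, hr₁, hrep₁, hq₁, hn₁⟩ := Runs.repeat (d := d) (x := x) (N := N)
      (body := p.compile (d + 2)) (F := p.exec) (T := (M + 2) ^ D) h
      (fun s' => exec_reg p hp.2.1 s')
      (Q := fun i t' => SameScratch d t t')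
      (fun t' _ hsc => hsc) (fun i t' t'' hq hsc => hq.trans hsc)
      (by
        intro i hi t' hrep hq
        obtain ⟨t₂, n₂, hr₂, hrep₂, hsc₂, hn₂⟩ := ih (d + 2) M _ t' hrep
          (fun r hr => by
            rw [State.setReg_reg]
            split_ifs with hrx
            · exact hi.le.trans hM.1
            · rw [iterState_reg_of_ne (fun s => exec_reg p (hp.2.2 r hr) s) hrx]
              exact hM.2 r hr)
        exact ⟨_, _, hr₂, hrep₂, hsc₂ _ (by omega), hsc₂ _ (by omega),
          hq.trans (hsc₂.mono (by omega)), hn₂⟩)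
    refine ⟨t₁, _, hr₁, hrep₁, hq₁, loop_time_le (N := s.reg N) hM.1 le_rfl (hn₁.trans ?_)⟩
    have : s.reg N * ((M + 2) ^ D + 4) ≤ s.reg N * ((M + 2) ^ D + 5) :=
      Nat.mul_le_mul_left _ (by omega)
    omega

end RAM

/-! ### Twins, replacement of items, and the kernel -/

namespace CGMinMax

section Combinatorics

variable {n k : ℕ} {G : Digraph (Fin n)}

theorem Acyclic.antisymm (hG : Acyclic G) {u v : Fin n} (h : Dominates G u v)
    (h' : Dominates G v u) : u = v := by
  rcases Relation.reflTransGen_iff_eq_or_transGen.1 h with h | h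
  · exact h.symm
  · exact absurd (h.trans_left h') (hG u)

/-- Two incomparable items with the same dominating and the same dominated items. -/
def IsTwin (G : Digraph (Fin n)) (u v : Fin n) : Prop :=
  u ≠ v ∧ ∀ w, ((Dominates G w u ∧ w ≠ u) ↔ (Dominates G w v ∧ w ≠ v)) ∧
    ((Dominates G u w ∧ w ≠ u) ↔ (Dominates G v w ∧ w ≠ v))

/-- `u` can replace `v`: either they are twins and `u` has the smaller index, or `u` dominates
`v` and is comparable with everything that dominates `v`. -/
def Precedes (G : Digraph (Fin n)) (u v : Fin n) : Prop :=
  (IsTwin G u v ∧ u < v) ∨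
    (u ≠ v ∧ Dominates G u v ∧ ∀ w, Dominates G w v → Dominates G w u ∨ Dominates G u w)

open Classical in
/-- Items that fewer than `k` items precede. -/
def IsKernelItem (G : Digraph (Fin n)) (k : ℕ) (v : Fin n) : Prop :=
  (Finset.univ.filter fun u => Precedes G u v).card < k

open Classical in
/-- The items that are not dominated by any item of `S`. -/
noncomputable def undominated (G : Digraph (Fin n)) (S : Finset (Fin n)) : Finset (Fin n) :=
  Finset.univ.filter fun v => ∀ u ∈ S, ¬ Dominates G u v

theorem mem_undominated {S : Finset (Fin n)} {v : Fin n} :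
    v ∈ undominated G S ↔ ∀ u ∈ S, ¬ Dominates G u v := by
  simp [undominated]

theorem dissatisfaction_eq (S : Finset (Fin n)) :
    dissatisfaction G S = (undominated G S).card := by
  simp only [dissatisfaction, undominated]
  congr

theorem IsTwin.symm {u v : Fin n} (h : IsTwin G u v) : IsTwin G v u :=
  ⟨h.1.symm, fun w => ⟨(h.2 w).1.symm, (h.2 w).2.symm⟩⟩

theorem IsTwin.trans {u v w : Fin n} (h : IsTwin G u v) (h' : IsTwin G v w) (hne : u ≠ w) :
    IsTwin G u w :=
  ⟨hne, fun x => ⟨(h.2 x).1.trans (h'.2 x).1, (h.2 x).2.trans (h'.2 x).2⟩⟩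

theorem IsTwin.not_dominates {u v : Fin n} (h : IsTwin G u v) : ¬ Dominates G u v :=
  fun hd => ((h.2 u).1.2 ⟨hd, h.1⟩).2 rfl

theorem IsTwin.dominates_left {u v w : Fin n} (h : IsTwin G u v) (hw : w ≠ u)
    (hd : Dominates G w u) : Dominates G w v :=
  ((h.2 w).1.1 ⟨hd, hw⟩).1

theorem IsTwin.dominates_right {u v w : Fin n} (h : IsTwin G u v) (hw : w ≠ u)
    (hd : Dominates G u w) : Dominates G v w :=
  ((h.2 w).2.1 ⟨hd, hw⟩).1

/-- Exchanging two twins is an automorphism of the domination order; the cases in which one twin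
would dominate the other do not occur. -/
theorem IsTwin.dominates_swap {u v : Fin n} (h : IsTwin G u v) {a b : Fin n}
    (hd : Dominates G a b) : Dominates G (Equiv.swap u v a) (Equiv.swap u v b) := by
  have h' := h.symm
  have hne := h.1
  rw [Equiv.swap_apply_def, Equiv.swap_apply_def]
  split_ifs with h1 h2 h3 h4 h5 h6 h7 h8
  · exact .refl
  · subst h1 h3; exact absurd hd h.not_dominates
  · subst h1; exact h.dominates_right (fun e => h2 e) hd
  · subst h4 h5; exact absurd hd h'.not_dominates
  · exact .refl
  · subst h4; exact h'.dominates_right (fun e => h6 e) hd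
  · subst h7; exact h.dominates_left h1 hd
  · subst h8; exact h'.dominates_left h4 hd
  · exact hd

theorem IsTwin.undominated_map {u v : Fin n} (h : IsTwin G u v) (S : Finset (Fin n)) :
    undominated G (S.map (Equiv.swap u v).toEmbedding) =
      (undominated G S).map (Equiv.swap u v).toEmbedding := by
  ext x
  simp only [mem_undominated, Finset.mem_map_equiv, Equiv.symm_swap]
  constructor
  · intro H y hy hd
    refine H (Equiv.swap u v y) (by simpa using hy) ?_
    simpa using h.dominates_swap hd
  · intro H y hy hd
    exact H _ hy (h.dominates_swap hd)

open Classical in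
/-- A weight of items that decreases along `Precedes` and along domination. -/
noncomputable def weight (G : Digraph (Fin n)) (v : Fin n) : ℕ :=
  1 + (n + 1) * (Finset.univ.filter fun u => Dominates G u v).card + v

/-- The set of dominators grows strictly from `u` to `v`, and one more dominator is worth `n + 1`,
more than any difference of indices. -/
theorem weight_lt_of_dominates (hG : Acyclic G) {u v : Fin n} (h : Dominates G u v)
    (hne : u ≠ v) : weight G u < weight G v := by
  classical
  have hlt : (Finset.univ.filter fun w => Dominates G w u).card <
      (Finset.univ.filter fun w => Dominates G w v).card := by
    refine Finset.card_lt_card (Finset.ssubset_iff_of_subset ?_ |>.2 ⟨v, ?_, ?_⟩)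
    · intro w hw
      simp only [Finset.mem_filter_univ] at hw ⊢
      exact hw.trans h
    · simp only [Finset.mem_filter_univ]
      exact .refl
    · simp only [Finset.mem_filter_univ]
      exact fun h' => hne (hG.antisymm h h')
  have h1 := Nat.mul_le_mul_left (n + 1) hlt
  have := u.isLt
  unfold weight
  rw [Nat.mul_succ] at h1
  omega

/-- Twins have the same strict dominators, and each adds itself, so the numbers of dominators agree
and the index decides. -/
theorem IsTwin.weight_lt {u v : Fin n} (h : IsTwin G u v) (hlt : u < v) :
    weight G u < weight G v := by
  classical
  have hcard : (Finset.univ.filter fun w => Dominates G w u).card =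
      (Finset.univ.filter fun w => Dominates G w v).card := by
    have h1 : ∀ x : Fin n, (Finset.univ.filter fun w => Dominates G w x) =
        insert x (Finset.univ.filter fun w => Dominates G w x ∧ w ≠ x) := by
      intro x
      ext w
      simp only [Finset.mem_filter_univ, Finset.mem_insert]
      by_cases hw : w = x
      · simp only [hw, true_or, iff_true]
        exact .refl
      · simp [hw]
    have h2 : (Finset.univ.filter fun w => Dominates G w u ∧ w ≠ u) =
        (Finset.univ.filter fun w => Dominates G w v ∧ w ≠ v) :=
      Finset.filter_congr fun w _ => (h.2 w).1
    rw [h1 u, h1 v, Finset.card_insert_of_notMem (by simp), Finset.card_insert_of_notMem (by simp),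
      h2]
  unfold weight
  rw [hcard]
  omega

theorem Precedes.weight_lt (hG : Acyclic G) {u v : Fin n} (h : Precedes G u v) :
    weight G u < weight G v := by
  rcases h with h | h
  · exact h.1.weight_lt h.2
  · exact weight_lt_of_dominates hG h.2.1 h.1

/-! ### The number of kernel items -/

/-- On a walk from outside, the first arc that enters the module can be redirected to any other
vertex of the module. -/
theorem IsModule.dominates_left {X : Finset (Fin n)} (hX : IsModule G X) {x y w : Fin n}
    (hx : x ∈ X) (hy : y ∈ X) (hw : w ∉ X) (h : Dominates G w x) : Dominates G w y := by
  induction h using Relation.ReflTransGen.head_induction_on with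
  | refl => exact absurd hx hw
  | @head a b hab _ ih =>
    by_cases hb : b ∈ X
    · have : a ∈ {u | G.Adj u b} \ (X : Set (Fin n)) := ⟨hab, hw⟩
      rw [(hX b hb y hy).1] at this
      exact .single this.1
    · exact .head hab (ih hb)

theorem IsModule.dominates_right {X : Finset (Fin n)} (hX : IsModule G X) {x y w : Fin n}
    (hx : x ∈ X) (hy : y ∈ X) (hw : w ∉ X) (h : Dominates G x w) : Dominates G y w := by
  induction h with
  | refl => exact absurd hx hw
  | @tail a b _ hab ih =>
    by_cases ha : a ∈ X
    · have : b ∈ {u | G.Adj a u} \ (X : Set (Fin n)) := ⟨hab, hw⟩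
      rw [(hX a ha y hy).2] at this
      exact .single this.1
    · exact .tail (ih ha) hab

/-- A walk from `x` to `y` would have to leave `X` at once, since `X` has no inner arcs. Its return
to `y` can be redirected to `x` by modularity, which closes a cycle. -/
theorem IsIndependent.not_dominates (hG : Acyclic G) {X : Finset (Fin n)} (hX : IsModule G X)
    (hI : IsIndependent G X) {x y : Fin n} (hx : x ∈ X) (hy : y ∈ X) (hne : x ≠ y) :
    ¬ Dominates G x y := by
  intro h
  rcases Relation.ReflTransGen.cases_head h with h | ⟨z, hxz, hzy⟩
  · exact hne h
  · have hz : z ∉ X := fun hz => hI x hx z hz hxz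
    exact hG x (.head' hxz (hX.dominates_left hy hx hz hzy))

theorem IsIndependent.isTwin (hG : Acyclic G) {X : Finset (Fin n)} (hX : IsModule G X)
    (hI : IsIndependent G X) {x y : Fin n} (hx : x ∈ X) (hy : y ∈ X) (hne : x ≠ y) :
    IsTwin G x y := by
  refine ⟨hne, fun w => ?_⟩
  by_cases hw : w ∈ X
  · have h1 : ∀ z ∈ X, ¬ (Dominates G w z ∧ w ≠ z) := fun z hz h =>
      hI.not_dominates hG hX hw hz h.2 h.1
    have h2 : ∀ z ∈ X, ¬ (Dominates G z w ∧ w ≠ z) := fun z hz h =>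
      hI.not_dominates hG hX hz hw h.2.symm h.1
    exact ⟨iff_of_false (h1 x hx) (h1 y hy), iff_of_false (h2 x hx) (h2 y hy)⟩
  · have h1 : ∀ z ∈ X, w ≠ z := fun z hz h => hw (h ▸ hz)
    have hx' := h1 x hx
    have hy' := h1 y hy
    exact ⟨⟨fun h => ⟨hX.dominates_left hx hy hw h.1, hy'⟩,
      fun h => ⟨hX.dominates_left hy hx hw h.1, hx'⟩⟩,
      ⟨fun h => ⟨hX.dominates_right hx hy hw h.1, hy'⟩,
      fun h => ⟨hX.dominates_right hy hx hw h.1, hx'⟩⟩⟩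

/-- The earlier item on the path precedes the later one: a dominator on the path is comparable with
everything on the path, and a dominator outside also dominates the earlier item because the path is
a module. -/
theorem InducesPath.precedes_total {X : Finset (Fin n)} (hX : IsModule G X)
    (hP : InducesPath G X) {x y : Fin n} (hx : x ∈ X) (hy : y ∈ X) (hne : x ≠ y) :
    Precedes G x y ∨ Precedes G y x := by
  obtain ⟨m, p, hp, hr, hadj⟩ := hP
  have hmem : ∀ i, p i ∈ X := fun i => by
    have : p i ∈ Set.range p := ⟨i, rfl⟩
    rwa [hr] at this
  have hdom : ∀ (d : ℕ) (i j : Fin (m + 1)), (i : ℕ) + d = j → Dominates G (p i) (p j) := by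
    intro d
    induction d with
    | zero =>
      intro i j h
      have : i = j := Fin.ext (by omega)
      subst this
      exact .refl
    | succ d ih =>
      intro i j h
      have hl : (i : ℕ) + d < m + 1 := by omega
      exact .tail (ih i ⟨_, hl⟩ rfl) ((hadj ⟨_, hl⟩ j).2 (by simp only; omega))
  have hle : ∀ i j : Fin (m + 1), i ≤ j → Dominates G (p i) (p j) := fun i j h =>
    hdom (j - i) i j (by have : (i : ℕ) ≤ j := h; omega)
  have key : ∀ i j : Fin (m + 1), i < j → Precedes G (p i) (p j) := by
    intro i j hij
    refine .inr ⟨fun h => hij.ne (hp h), hle i j hij.le, fun w hw => ?_⟩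
    by_cases hwX : w ∈ X
    · have : w ∈ Set.range p := by rw [hr]; exact hwX
      obtain ⟨l, rfl⟩ := this
      rcases le_total l i with h | h
      · exact .inl (hle _ _ h)
      · exact .inr (hle _ _ h)
    · exact .inl (hX.dominates_left (hmem j) (hmem i) hwX hw)
  have hx' : x ∈ Set.range p := by rw [hr]; exact hx
  have hy' : y ∈ Set.range p := by rw [hr]; exact hy
  obtain ⟨i, rfl⟩ := hx'
  obtain ⟨j, rfl⟩ := hy'
  rcases lt_trichotomy i j with h | h | h
  · exact .inl (key _ _ h)
  · exact absurd (congrArg p h) hne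
  · exact .inr (key _ _ h)

open Classical in
-- Precedence lowers the weight, so the heaviest kernel item of `X` is preceded by all other kernel
-- items of `X`; being a kernel item, it leaves room for fewer than `k` of them.
theorem card_kernel_le_of_total (hG : Acyclic G) {X : Finset (Fin n)}
    (hX : ∀ x ∈ X, ∀ y ∈ X, x ≠ y → Precedes G x y ∨ Precedes G y x) :
    (X.filter (IsKernelItem G k)).card ≤ k := by
  rcases (X.filter (IsKernelItem G k)).eq_empty_or_nonempty with h | h
  · simp [h]
  obtain ⟨v, hv, hmax⟩ := Finset.exists_max_image _ (weight G) h
  have hsub : (X.filter (IsKernelItem G k)).erase v ⊆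
      Finset.univ.filter fun u => Precedes G u v := by
    intro u hu
    rw [Finset.mem_erase] at hu
    rw [Finset.mem_filter_univ]
    rcases hX u (Finset.mem_filter.1 hu.2).1 v (Finset.mem_filter.1 hv).1 hu.1 with h | h
    · exact h
    · exact absurd (hmax u hu.2) (not_le.2 (h.weight_lt hG))
  have h1 := Finset.card_le_card hsub
  have h2 : (Finset.univ.filter fun u => Precedes G u v).card < k := (Finset.mem_filter.1 hv).2
  have h3 := Finset.card_erase_add_one hv
  omega

open Classical in
theorem card_kernel_le (hG : Acyclic G) (k : ℕ) :
    (Finset.univ.filter (IsKernelItem G k)).card ≤ k * pathIndepNumber G := by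
  obtain ⟨P, hP, hcard⟩ := (pathIndepNumber_isLeast G hG).1
  have hcover : Finset.univ.filter (IsKernelItem G k) ⊆
      P.parts.biUnion fun X => X.filter (IsKernelItem G k) := by
    intro v hv
    obtain ⟨X, hX, hvX⟩ := P.exists_mem (Finset.mem_univ v)
    exact Finset.mem_biUnion.2 ⟨X, by convert hX, by
      simp only [Finset.mem_filter] at hv ⊢; exact ⟨hvX, hv.2⟩⟩
  have h1 := (Finset.card_le_card hcover).trans
    (Finset.card_biUnion_le_card_mul P.parts _ k fun X hX => ?_)
  · rwa [hcard, mul_comm] at h1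
  · refine card_kernel_le_of_total hG fun x hx y hy hne => ?_
    obtain ⟨hmod, hpath | hind⟩ := hP X (by convert hX)
    · exact hpath.precedes_total hmod hx hy hne
    · have ht := hind.isTwin hG hmod hx hy hne
      rcases lt_or_gt_of_ne hne with h | h
      · exact .inl (.inl ⟨ht, h⟩)
      · exact .inr (.inl ⟨ht.symm, h⟩)

/-! ### Certificates supported on the kernel -/

/-- A certificate for the threshold `δ`: every agent `i` receives the items of `σ i` and, in
addition, the items of `E i`, for which only the items themselves are counted as dominated. -/
structure IsCertificate (G : Digraph (Fin n)) (δ : ℤ) (σ E : Fin k → Finset (Fin n)) : Prop where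
  disjoint : ∀ i j, i ≠ j → Disjoint (σ i) (σ j)
  disjoint_extra : ∀ i j, i ≠ j → Disjoint (E i) (E j)
  disjoint_mixed : ∀ i j, Disjoint (σ i) (E j)
  twin : ∀ i, ∀ v ∈ E i, ∃ u, IsTwin G v u
  le : ∀ i, ((undominated G (σ i) \ E i).card : ℤ) ≤ δ

/-- The total weight of the allocated items. -/
noncomputable def totalWeight (G : Digraph (Fin n)) (σ : Fin k → Finset (Fin n)) : ℕ :=
  ∑ i, ∑ v ∈ σ i, weight G v

theorem totalWeight_update_erase_lt (σ : Fin k → Finset (Fin n)) (i : Fin k) {w : Fin n}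
    (hw : w ∈ σ i) :
    totalWeight G (Function.update σ i ((σ i).erase w)) < totalWeight G σ := by
  refine Finset.sum_lt_sum (fun j _ => ?_) ⟨i, Finset.mem_univ i, ?_⟩
  · by_cases h : j = i
    · subst h
      rw [Function.update_self]
      exact Finset.sum_le_sum_of_subset (Finset.erase_subset _ _)
    · rw [Function.update_of_ne h]
  · rw [Function.update_self, ← Finset.sum_erase_add _ _ hw]
    have : 0 < weight G w := by unfold weight; omega
    omega

theorem update_erase_subset (σ : Fin k → Finset (Fin n)) (i j : Fin k) (w : Fin n) :
    Function.update σ i ((σ i).erase w) j ⊆ σ j := by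
  by_cases h : j = i
  · subst h
    rw [Function.update_self]
    exact Finset.erase_subset _ _
  · rw [Function.update_of_ne h]

/-- By transitivity `u` dominates whatever `w` dominates, so the undominated items do not change for
the worse. -/
theorem IsCertificate.erase_dominated {δ : ℤ} {σ E : Fin k → Finset (Fin n)}
    (h : IsCertificate G δ σ E) {i : Fin k} {u w : Fin n} (hu : u ∈ σ i) (hne : u ≠ w)
    (hd : Dominates G u w) :
    IsCertificate G δ (Function.update σ i ((σ i).erase w)) E where
  disjoint a b hab := (h.disjoint a b hab).mono (update_erase_subset σ i a w)
    (update_erase_subset σ i b w)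
  disjoint_extra := h.disjoint_extra
  disjoint_mixed a b := (h.disjoint_mixed a b).mono_left (update_erase_subset σ i a w)
  twin := h.twin
  le j := by
    by_cases hj : j = i
    · subst hj
      rw [Function.update_self]
      refine le_trans ?_ (h.le j)
      refine Nat.cast_le.2 (Finset.card_le_card (Finset.sdiff_subset_sdiff ?_ subset_rfl))
      intro x hx
      rw [mem_undominated] at hx ⊢
      intro y hy hyx
      by_cases hyw : y = w
      · subst hyw
        exact hx u (Finset.mem_erase.2 ⟨hne, hu⟩) (hd.trans hyx)
      · exact hx y (Finset.mem_erase.2 ⟨hyw, hy⟩) hyx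
    · rw [Function.update_of_ne hj]
      exact h.le j

/-- The twin `u` stays in the bundle and dominates everything that `w` dominates except `w` itself,
which is exactly what an extra item is credited with. -/
theorem IsCertificate.move_twin {δ : ℤ} {σ E : Fin k → Finset (Fin n)}
    (h : IsCertificate G δ σ E) {i : Fin k} {u w : Fin n} (hu : u ∈ σ i) (hw : w ∈ σ i)
    (ht : IsTwin G w u) :
    IsCertificate G δ (Function.update σ i ((σ i).erase w))
      (Function.update E i (insert w (E i))) := by
  have hwE : ∀ j, w ∉ E j := fun j hj => Finset.disjoint_left.1 (h.disjoint_mixed i j) hw hj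
  refine ⟨fun a b hab => (h.disjoint a b hab).mono (update_erase_subset σ i a w)
    (update_erase_subset σ i b w), ?_, ?_, ?_, ?_⟩
  · intro a b hab
    by_cases ha : a = i
    · subst ha
      rw [Function.update_self, Function.update_of_ne hab.symm, Finset.disjoint_insert_left]
      exact ⟨hwE b, h.disjoint_extra a b hab⟩
    · rw [Function.update_of_ne ha]
      by_cases hb : b = i
      · subst hb
        rw [Function.update_self, Finset.disjoint_insert_right]
        exact ⟨hwE a, h.disjoint_extra a b hab⟩
      · rw [Function.update_of_ne hb]
        exact h.disjoint_extra a b hab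
  · intro a b
    have h0 := (h.disjoint_mixed a b).mono_left (update_erase_subset σ i a w)
    by_cases hb : b = i
    · subst hb
      rw [Function.update_self, Finset.disjoint_insert_right]
      refine ⟨?_, h0⟩
      by_cases ha : a = b
      · subst ha
        simp
      · rw [Function.update_of_ne ha]
        exact Finset.disjoint_right.1 (h.disjoint a b ha) hw
    · rwa [Function.update_of_ne hb]
  · intro a v hv
    by_cases ha : a = i
    · subst ha
      rw [Function.update_self, Finset.mem_insert] at hv
      rcases hv with rfl | hv
      · exact ⟨u, ht⟩
      · exact h.twin a v hv
    · rw [Function.update_of_ne ha] at hv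
      exact h.twin a v hv
  · intro j
    by_cases hj : j = i
    · subst hj
      rw [Function.update_self, Function.update_self]
      refine le_trans ?_ (h.le j)
      refine Nat.cast_le.2 (Finset.card_le_card ?_)
      intro x hx
      rw [Finset.mem_sdiff, mem_undominated, Finset.mem_insert, not_or] at hx
      rw [Finset.mem_sdiff, mem_undominated]
      refine ⟨fun y hy hyx => ?_, hx.2.2⟩
      by_cases hyw : y = w
      · subst hyw
        exact hx.1 u (Finset.mem_erase.2 ⟨ht.1.symm, hu⟩) (ht.dominates_right hx.2.1 hyx)
      · exact hx.1 y (Finset.mem_erase.2 ⟨hyw, hy⟩) hyx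
    · rw [Function.update_of_ne hj, Function.update_of_ne hj]
      exact h.le j

/-- For twins, the exchange is an automorphism of domination and is applied to bundles and extras
alike, so `u` may be an extra item. If instead `u` dominates `v`, then `u` cannot be an extra item,
the extras are left fixed by the swap, and the new bundle dominates at least as much. -/
theorem IsCertificate.swap {δ : ℤ} {σ E : Fin k → Finset (Fin n)}
    (h : IsCertificate G δ σ E) {i : Fin k} {u v : Fin n} (hv : v ∈ σ i)
    (hu : ∀ j, u ∉ σ j) (hp : Precedes G u v) :
    IsCertificate G δ (fun j => (σ j).map (Equiv.swap u v).toEmbedding)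
      (fun j => (E j).map (Equiv.swap u v).toEmbedding) := by
  have hvE : ∀ j, v ∉ E j := fun j hj => Finset.disjoint_left.1 (h.disjoint_mixed i j) hv hj
  rcases hp with ⟨ht, -⟩ | ⟨hne, hd, hcomp⟩
  · refine ⟨fun a b hab => (Finset.disjoint_map _).2 (h.disjoint a b hab),
      fun a b hab => (Finset.disjoint_map _).2 (h.disjoint_extra a b hab),
      fun a b => (Finset.disjoint_map _).2 (h.disjoint_mixed a b), ?_, ?_⟩
    · intro j x hx
      rw [Finset.mem_map_equiv, Equiv.symm_swap] at hx
      by_cases hxu : x = u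
      · exact ⟨v, hxu ▸ ht⟩
      by_cases hxv : x = v
      · exact ⟨u, hxv ▸ ht.symm⟩
      rw [Equiv.swap_apply_of_ne_of_ne hxu hxv] at hx
      exact h.twin j x hx
    · intro j
      rw [ht.undominated_map, ← Finset.map_sdiff, Finset.card_map]
      exact h.le j
  -- Extra items have twins. A twin `w` of `u` dominates `v` as `u` does, so `hcomp` makes `w`
  -- comparable with `u`, which twins are not.
  · have huE : ∀ j, u ∉ E j := by
      intro j hj
      obtain ⟨w, hw⟩ := h.twin j u hj
      have h1 : Dominates G w v := by
        refine hw.dominates_right ?_ hd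
        exact hne.symm
      rcases hcomp w h1 with h2 | h2
      · exact hw.symm.not_dominates h2
      · exact hw.not_dominates h2
    have hE : ∀ j, (E j).map (Equiv.swap u v).toEmbedding = E j := by
      intro j
      ext x
      rw [Finset.mem_map_equiv, Equiv.symm_swap]
      by_cases hxu : x = u
      · subst hxu
        simp [hvE, huE]
      by_cases hxv : x = v
      · subst hxv
        simp [hvE, huE]
      rw [Equiv.swap_apply_of_ne_of_ne hxu hxv]
    refine ⟨fun a b hab => (Finset.disjoint_map _).2 (h.disjoint a b hab),
      fun a b hab => (Finset.disjoint_map _).2 (h.disjoint_extra a b hab),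
      fun a b => (Finset.disjoint_map _).2 (h.disjoint_mixed a b), ?_, ?_⟩
    · intro j x hx
      rw [hE] at hx
      exact h.twin j x hx
    · intro j
      rw [hE]
      refine le_trans ?_ (h.le j)
      refine Nat.cast_le.2 (Finset.card_le_card (Finset.sdiff_subset_sdiff ?_ subset_rfl))
      intro x hx
      rw [mem_undominated] at hx ⊢
      intro y hy hyx
      refine hx (Equiv.swap u v y) (Finset.mem_map_of_mem _ hy) ?_
      by_cases hyv : y = v
      · subst hyv
        rw [Equiv.swap_apply_right]
        exact hd.trans hyx
      · rwa [Equiv.swap_apply_of_ne_of_ne (fun e => hu j (by rwa [e] at hy)) hyv]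

theorem totalWeight_swap_lt {σ : Fin k → Finset (Fin n)} {i : Fin k} {u v : Fin n}
    (hv : v ∈ σ i) (hu : ∀ j, u ∉ σ j) (hlt : weight G u < weight G v) :
    totalWeight G (fun j => (σ j).map (Equiv.swap u v).toEmbedding) < totalWeight G σ := by
  have hle : ∀ j, ∀ x ∈ σ j, weight G (Equiv.swap u v x) ≤ weight G x := by
    intro j x hx
    by_cases hxv : x = v
    · subst hxv
      rw [Equiv.swap_apply_right]
      exact hlt.le
    · rw [Equiv.swap_apply_of_ne_of_ne (fun e => hu j (by rwa [e] at hx)) hxv]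
  refine Finset.sum_lt_sum (fun j _ => ?_) ⟨i, Finset.mem_univ i, ?_⟩
  · rw [Finset.sum_map]
    exact Finset.sum_le_sum (hle j)
  · rw [Finset.sum_map]
    refine Finset.sum_lt_sum (hle i) ⟨v, hv, ?_⟩
    simpa using hlt

/-- If no cleaning move applies, each of the `k` bundles contains at most one predecessor of `v` and
bundle `i` contains none. There are at least `k` predecessors, so one of them is free to be
exchanged with `v`. -/
theorem IsCertificate.exists_lt (hG : Acyclic G) {δ : ℤ} {σ E : Fin k → Finset (Fin n)}
    (h : IsCertificate G δ σ E) {i : Fin k} {v : Fin n} (hv : v ∈ σ i)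
    (hker : ¬ IsKernelItem G k v) :
    ∃ σ' E' : Fin k → Finset (Fin n), IsCertificate G δ σ' E' ∧
      totalWeight G σ' < totalWeight G σ := by
  classical
  by_cases hA : ∃ j, ∃ u ∈ σ j, ∃ w ∈ σ j, u ≠ w ∧ Dominates G u w
  · obtain ⟨j, u, hu, w, hw, hne, hd⟩ := hA
    exact ⟨_, _, h.erase_dominated hu hne hd, totalWeight_update_erase_lt σ j hw⟩
  by_cases hT : ∃ j, ∃ u ∈ σ j, ∃ w ∈ σ j, IsTwin G w u
  · obtain ⟨j, u, hu, w, hw, ht⟩ := hT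
    exact ⟨_, _, h.move_twin hu hw ht, totalWeight_update_erase_lt σ j hw⟩
  push Not at hA hT
  suffices hfree : ∃ u, Precedes G u v ∧ ∀ j, u ∉ σ j by
    obtain ⟨u, hp, hu⟩ := hfree
    exact ⟨_, _, h.swap hv hu hp, totalWeight_swap_lt hv hu (hp.weight_lt hG)⟩
  by_contra! hcon
  have : Nonempty (Fin k) := ⟨i⟩
  choose! f hf using hcon
  -- Two twins of `v` are twins of each other; a twin of `v` is dominated by every other strict
  -- dominator of `v`; and two dominators are comparable by the last clause of `Precedes`. A cleaned
  -- bundle admits none of these.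
  have huniq : ∀ j, ∀ u ∈ σ j, ∀ w ∈ σ j, Precedes G u v → Precedes G w v → u = w := by
    intro j u hu w hw hpu hpw
    by_contra hne
    rcases hpu with ⟨hu1, -⟩ | ⟨-, hu2, hu3⟩
    · rcases hpw with ⟨hw1, -⟩ | ⟨-, hw2, -⟩
      · exact hT j w hw u hu (hu1.trans hw1.symm hne)
      · exact hA j w hw u hu (Ne.symm hne) (by
          by_cases hwv : w = v
          · subst hwv
            exact absurd hu1 (hT j w hw u hu)
          · exact hu1.symm.dominates_left hwv hw2)
    · rcases hpw with ⟨hw1, -⟩ | ⟨-, hw2, -⟩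
      · exact hA j u hu w hw hne (by
          by_cases huv : u = v
          · subst huv
            exact absurd hw1 (hT j u hu w hw)
          · exact hw1.symm.dominates_left huv hu2)
      · rcases hu3 w hw2 with h' | h'
        · exact hA j w hw u hu (Ne.symm hne) h'
        · exact hA j u hu w hw hne h'
  have hni : ∀ u, Precedes G u v → f u ≠ i := by
    intro u hp hfi
    have hui := hf u hp
    rw [hfi] at hui
    rcases hp with ⟨h1, -⟩ | ⟨h1, h2, -⟩
    · exact hT i v hv u hui h1
    · exact hA i u hui v hv h1 h2
  -- The owner map `f` is injective on the predecessors of `v` and misses `i`, so there are at most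
  -- `k - 1` of them.
  have hcard : (Finset.univ.filter fun u => Precedes G u v).card ≤
      (Finset.univ.erase i).card := by
    refine Finset.card_le_card_of_injOn f (fun u hu => ?_) fun u hu w hw huw => ?_
    · have hu := (Finset.mem_filter.1 hu).2
      simpa using hni u hu
    · have hu := (Finset.mem_filter.1 hu).2
      have hw := (Finset.mem_filter.1 hw).2
      have hfw := hf w hw
      rw [← huw] at hfw
      exact huniq _ u (hf u hu) w hfw hu hw
  have h1 := Finset.card_erase_add_one (Finset.mem_univ i)
  rw [Finset.card_univ, Fintype.card_fin] at h1
  exact hker (by unfold IsKernelItem; omega)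

theorem IsCertificate.exists_kernel (hG : Acyclic G) {δ : ℤ} {σ E : Fin k → Finset (Fin n)}
    (h : IsCertificate G δ σ E) :
    ∃ σ' E' : Fin k → Finset (Fin n), IsCertificate G δ σ' E' ∧
      ∀ i, ∀ v ∈ σ' i, IsKernelItem G k v := by
  induction hw : totalWeight G σ using Nat.strong_induction_on generalizing σ E with
  | _ N ih =>
    by_cases hker : ∀ i, ∀ v ∈ σ i, IsKernelItem G k v
    · exact ⟨σ, E, h, hker⟩
    · push Not at hker
      obtain ⟨i, v, hv, hk⟩ := hker
      obtain ⟨σ', E', h', hlt⟩ := h.exists_lt hG hv hk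
      exact ih _ (hw ▸ hlt) h' rfl

/-! ### Hall's theorem for the extra items -/

/-- The number of further items that an agent with the items `S` needs. -/
noncomputable def demand (G : Digraph (Fin n)) (δ : ℤ) (S : Finset (Fin n)) : ℕ :=
  (((undominated G S).card : ℤ) - δ).toNat

/-- Each agent is replaced by `demand` many copies to be matched to distinct items. Copies of one
agent have the same neighbours, so Hall's condition has to be tested only for sets that contain all
copies of each of their agents, that is, for sets `B` of agents. -/
theorem exists_extra_iff (δ : ℤ) (S : Fin k → Finset (Fin n)) (F : Finset (Fin n)) :
    (∀ B : Finset (Fin k), ∑ i ∈ B, demand G δ (S i) ≤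
      (F.filter fun v => ∃ i ∈ B, v ∈ undominated G (S i)).card) ↔
    ∃ E : Fin k → Finset (Fin n), (∀ i j, i ≠ j → Disjoint (E i) (E j)) ∧ (∀ i, E i ⊆ F) ∧
      ∀ i, ((undominated G (S i) \ E i).card : ℤ) ≤ δ := by
  classical
  constructor
  · intro H
    have hall := (Finset.all_card_le_biUnion_card_iff_exists_injective
      (fun x : Σ i : Fin k, Fin (demand G δ (S i)) =>
        F.filter fun v => v ∈ undominated G (S x.1))).1 (by
      intro s
      -- Completing `s` to all copies of the agents that occur in it enlarges the left side of
      -- Hall's condition and keeps the neighbourhood.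
      calc s.card ≤ ((s.image Sigma.fst).sigma fun i => Finset.univ).card :=
            Finset.card_le_card fun x hx => Finset.mem_sigma.2
              ⟨Finset.mem_image_of_mem _ hx, Finset.mem_univ _⟩
        _ = ∑ i ∈ s.image Sigma.fst, demand G δ (S i) := by
            rw [Finset.card_sigma]
            simp
        _ ≤ _ := H _
        _ ≤ _ := Finset.card_le_card fun v hv => by
            simp only [Finset.mem_filter, Finset.mem_image, Finset.mem_biUnion] at hv ⊢
            obtain ⟨hF, _, ⟨x, hx, rfl⟩, hv⟩ := hv
            exact ⟨x, hx, hF, hv⟩)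
    obtain ⟨f, hinj, hf⟩ := hall
    refine ⟨fun i => Finset.univ.image fun a => f ⟨i, a⟩, ?_, ?_, ?_⟩
    · intro i j hij
      rw [Finset.disjoint_left]
      intro v hv hv'
      simp only [Finset.mem_image, Finset.mem_univ, true_and] at hv hv'
      obtain ⟨a, rfl⟩ := hv
      obtain ⟨b, hb⟩ := hv'
      exact hij (congrArg Sigma.fst (hinj hb)).symm
    · intro i v hv
      simp only [Finset.mem_image, Finset.mem_univ, true_and] at hv
      obtain ⟨a, rfl⟩ := hv
      exact (Finset.mem_filter.1 (hf ⟨i, a⟩)).1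
    · intro i
      have hsub : (Finset.univ.image fun a => f ⟨i, a⟩) ⊆ undominated G (S i) := by
        intro v hv
        simp only [Finset.mem_image, Finset.mem_univ, true_and] at hv
        obtain ⟨a, rfl⟩ := hv
        exact (Finset.mem_filter.1 (hf ⟨i, a⟩)).2
      have hcard : (Finset.univ.image fun a => f ⟨i, a⟩).card = demand G δ (S i) := by
        rw [Finset.card_image_of_injective _ fun a b hab => by
          simpa using hinj hab]
        simp
      have h1 := Finset.card_sdiff_add_card_eq_card hsub
      have h2 : demand G δ (S i) = (((undominated G (S i)).card : ℤ) - δ).toNat := rfl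
      rw [hcard] at h1
      simp only
      omega
  · rintro ⟨E, hdisj, hF, hle⟩ B
    calc ∑ i ∈ B, demand G δ (S i) ≤ ∑ i ∈ B, (undominated G (S i) ∩ E i).card :=
          Finset.sum_le_sum fun i _ => by
            have h1 := Finset.card_sdiff_add_card_inter (undominated G (S i)) (E i)
            have h2 := hle i
            unfold demand
            omega
      _ = (B.biUnion fun i => undominated G (S i) ∩ E i).card := by
          rw [Finset.card_biUnion]
          intro i _ j _ hij
          exact (hdisj i j hij).mono Finset.inter_subset_right Finset.inter_subset_right
      _ ≤ _ := Finset.card_le_card fun v hv => by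
          simp only [Finset.mem_filter, Finset.mem_biUnion, Finset.mem_inter] at hv ⊢
          obtain ⟨i, hi, hv, hv'⟩ := hv
          exact ⟨hF i hv', i, hi, hv⟩

/-- The items of agent `i` under the ownership function `own`; the value `0` means that an item
has no owner. -/
def ownedBy (own : Fin n → ℕ) (i : ℕ) : Finset (Fin n) :=
  Finset.univ.filter fun v => own v = i + 1

/-- Forward, the allocation is a certificate without extras and is pushed into the kernel. Backward,
bundles and extras are united; an extra item dominates at least itself, so its being a twin is no
longer needed. -/
theorem exists_allocation_iff (hG : Acyclic G) (δ : ℤ) (k : ℕ) :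
    (∃ π : Fin k → Finset (Fin n), IsAllocation π ∧ ∀ i, (dissatisfaction G (π i) : ℤ) ≤ δ) ↔
    ∃ own : Fin n → ℕ, (∀ v, own v ≤ k) ∧ (∀ v, ¬ IsKernelItem G k v → own v = 0) ∧
      ∀ B : Finset (Fin k), ∑ i ∈ B, demand G δ (ownedBy own i) ≤
        ((Finset.univ.filter fun v => own v = 0).filter fun v =>
          ∃ i ∈ B, v ∈ undominated G (ownedBy own i)).card := by
  classical
  constructor
  · rintro ⟨π, hπ, hle⟩
    have hcert : IsCertificate G δ π fun _ => ∅ :=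
      ⟨hπ, by simp, by simp, by simp, by simpa [dissatisfaction_eq] using hle⟩
    obtain ⟨σ, E, h, hker⟩ := hcert.exists_kernel hG
    have hone : ∀ v, ∀ i j, v ∈ σ i → v ∈ σ j → i = j := by
      intro v i j hi hj
      by_contra hne
      exact Finset.disjoint_left.1 (h.disjoint i j hne) hi hj
    -- The bundles are disjoint, so the choice is forced. The shift by one reserves `0` for items
    -- without owner.
    let own : Fin n → ℕ := fun v => if hv : ∃ i, v ∈ σ i then (hv.choose : ℕ) + 1 else 0
    have hown : ∀ v i, v ∈ σ i → own v = i + 1 := by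
      intro v i hi
      have hv : ∃ i, v ∈ σ i := ⟨i, hi⟩
      simp only [own, dif_pos hv]
      rw [hone v _ i hv.choose_spec hi]
    have hown0 : ∀ v, (∀ i, v ∉ σ i) → own v = 0 := by
      intro v hv
      have : ¬ ∃ i, v ∈ σ i := by simpa using hv
      simp only [own, dif_neg this]
    have hby : ∀ i : Fin k, ownedBy own i = σ i := by
      intro i
      ext v
      simp only [ownedBy, Finset.mem_filter_univ]
      refine ⟨fun hv => ?_, hown v i⟩
      by_cases hex : ∃ j, v ∈ σ j
      · obtain ⟨j, hj⟩ := hex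
        rw [hown v j hj] at hv
        have : j = i := Fin.ext (by omega)
        exact this ▸ hj
      · rw [hown0 v (by simpa using hex)] at hv
        omega
    refine ⟨own, fun v => ?_, fun v hv => hown0 v fun i hi => hv (hker i v hi), ?_⟩
    · by_cases hex : ∃ j, v ∈ σ j
      · obtain ⟨j, hj⟩ := hex
        rw [hown v j hj]
        omega
      · rw [hown0 v (by simpa using hex)]
        omega
    · refine (exists_extra_iff δ (fun i : Fin k => ownedBy own i) _).2
        ⟨E, h.disjoint_extra, fun i v hv => ?_, fun i => ?_⟩
      · rw [Finset.mem_filter_univ]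
        exact hown0 v fun j hj => Finset.disjoint_left.1 (h.disjoint_mixed j i) hj hv
      · rw [hby]
        exact h.le i
  · rintro ⟨own, -, -, H⟩
    obtain ⟨E, hdisj, hF, hle⟩ := (exists_extra_iff δ (fun i : Fin k => ownedBy own i) _).1 H
    have hmixed : ∀ i j, Disjoint (ownedBy own i) (E j) := by
      intro i j
      rw [Finset.disjoint_left]
      intro v hv hv'
      have h1 := (Finset.mem_filter.1 (hF j hv')).2
      have h2 : own v = i + 1 := (Finset.mem_filter.1 hv).2
      omega
    refine ⟨fun i => ownedBy own i ∪ E i, fun i j hij => ?_, fun i => le_trans ?_ (hle i)⟩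
    · rw [Finset.disjoint_union_left, Finset.disjoint_union_right, Finset.disjoint_union_right]
      refine ⟨⟨?_, hmixed i j⟩, (hmixed j i).symm, hdisj i j hij⟩
      rw [Finset.disjoint_left]
      intro v hv hv'
      have h1 : own v = i + 1 := (Finset.mem_filter.1 hv).2
      have h2 : own v = j + 1 := (Finset.mem_filter.1 hv').2
      exact hij (Fin.ext (by omega))
    · rw [dissatisfaction_eq]
      refine Nat.cast_le.2 (Finset.card_le_card fun v hv => ?_)
      rw [mem_undominated] at hv
      rw [Finset.mem_sdiff, mem_undominated]
      exact ⟨fun u hu => hv u (Finset.mem_union_left _ hu),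
        fun hE => hv v (Finset.mem_union_right _ hE) .refl⟩

end Combinatorics

end CGMinMax

namespace RAM

/-! ## Derived expressions -/

namespace Ex

/-- Nonzero values represent truth. -/
def Holds (e : Ex) (s : State) : Prop := e.eval s ≠ 0

def not (a : Ex) : Ex := .ite a (.const 0) (.const 1)
def and (a b : Ex) : Ex := .ite a b (.const 0)
def or (a b : Ex) : Ex := .ite a (.const 1) b
def imp (a b : Ex) : Ex := .ite a b (.const 1)
def iff (a b : Ex) : Ex := .ite a b b.not
def le (a b : Ex) : Ex := .sub (.const 1) (.sub a b)
def lt (a b : Ex) : Ex := .sub b a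
def eq (a b : Ex) : Ex := (a.le b).and (b.le a)
def all (x N : ℕ) (e : Ex) : Ex := (Ex.sum x N e.not).not
def count (x N : ℕ) (e : Ex) : Ex := .sum x N (.ite e (.const 1) (.const 0))

variable (a b e : Ex) (x N : ℕ) (s : State)

@[simp] theorem holds_const (c : ℕ) : (Ex.const c).Holds s ↔ c ≠ 0 := Iff.rfl

@[simp] theorem holds_not : a.not.Holds s ↔ ¬ a.Holds s := by
  unfold Holds not
  by_cases h : a.eval s = 0 <;> simp [eval, h]

@[simp] theorem holds_and : (a.and b).Holds s ↔ a.Holds s ∧ b.Holds s := by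
  unfold Holds and
  by_cases h : a.eval s = 0 <;> simp [eval, h]

@[simp] theorem holds_or : (a.or b).Holds s ↔ a.Holds s ∨ b.Holds s := by
  unfold Holds or
  by_cases h : a.eval s = 0 <;> simp [eval, h]

@[simp] theorem holds_imp : (a.imp b).Holds s ↔ (a.Holds s → b.Holds s) := by
  unfold Holds imp
  by_cases h : a.eval s = 0 <;> simp [eval, h]

@[simp] theorem holds_iff : (a.iff b).Holds s ↔ (a.Holds s ↔ b.Holds s) := by
  have h1 := holds_not b s
  unfold Holds at h1
  unfold Holds iff
  by_cases h : a.eval s = 0 <;> simp [eval, h] at h1 ⊢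
  exact h1

@[simp] theorem holds_le : (a.le b).Holds s ↔ a.eval s ≤ b.eval s := by
  unfold Holds le
  simp only [eval]
  omega

@[simp] theorem holds_lt : (a.lt b).Holds s ↔ a.eval s < b.eval s := by
  unfold Holds lt
  simp only [eval]
  omega

@[simp] theorem holds_eq : (a.eq b).Holds s ↔ a.eval s = b.eval s := by
  unfold eq
  rw [holds_and, holds_le, holds_le, le_antisymm_iff]

@[simp] theorem holds_sum : (Ex.sum x N e).Holds s ↔ ∃ i < s.reg N, e.Holds (s.setReg x i) := by
  unfold Holds
  simp [eval, Finset.sum_eq_zero_iff]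

@[simp] theorem holds_all : (Ex.all x N e).Holds s ↔ ∀ i < s.reg N, e.Holds (s.setReg x i) := by
  unfold all
  simp

open Classical in
theorem eval_ite_holds : (Ex.ite e a b).eval s = if e.Holds s then a.eval s else b.eval s := by
  unfold Holds
  by_cases h : e.eval s = 0 <;> simp [eval, h]

open Classical in
theorem eval_count_fin {n : ℕ} (hn : s.reg N = n) : (Ex.count x N e).eval s =
    (Finset.univ.filter fun i : Fin n => e.Holds (s.setReg x i)).card := by
  subst hn
  rw [Finset.card_filter, count, eval, Finset.sum_range]
  exact Finset.sum_congr rfl fun i _ => by rw [eval_ite_holds]; rfl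

end Ex

/-! ## Rules for loops -/

theorem iterState_induction {x : ℕ} {F : State → State} {s : State} (P : ℕ → State → Prop) (N : ℕ)
    (h0 : P 0 s) (hstep : ∀ i < N, ∀ s', P i s' → P (i + 1) (F (s'.setReg x i))) :
    P N (iterState x F s N) := by
  suffices h : ∀ i ≤ N, P i (iterState x F s i) from h N le_rfl
  intro i
  induction i with
  | zero => exact fun _ => h0
  | succ i ih => exact fun hi => hstep i hi _ (ih (by omega))

/-- The entry with row register `u` and column register `v` of the matrix in array `A`, where
register `2` contains the number of columns. -/
def Ex.cell (A u v : ℕ) : Ex := .get A (.add (.sum 30 2 (.var u)) (.var v))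

/-- The product is a sum with constant summand. Its dummy index is register 30, which therefore must
not hold the row. -/
theorem Ex.eval_cell (A u v : ℕ) (s : State) (hu : u ≠ 30) :
    (Ex.cell A u v).eval s = s.arr A (s.reg 2 * s.reg u + s.reg v) := by
  simp [cell, eval, State.setReg_reg_of_ne, hu]

/-- Fill the matrix in array `A` with the values of `e`; the row is register `20`, the column is
register `21`. -/
def Stmt.tabulate (A : ℕ) (e : Ex) : Stmt :=
  .loop 20 2 (.loop 21 2 (.store A (.add (.sum 30 2 (.var 20)) (.var 21)) e))

/-- Distinct pairs address distinct cells by division with remainder. Array `A` is partly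
overwritten while `e` is evaluated, so the hypothesis on `e` grants nothing about its contents. -/
theorem Stmt.exec_tabulate {A : ℕ} {e : Ex} {f : ℕ → ℕ → ℕ} (s : State)
    (he : ∀ s' : State, (∀ r, r ≠ 20 → r ≠ 21 → s'.reg r = s.reg r) →
      (∀ B, B ≠ A → s'.arr B = s.arr B) → s'.reg 20 < s.reg 2 → s'.reg 21 < s.reg 2 →
      e.eval s' = f (s'.reg 20) (s'.reg 21)) :
    ((tabulate A e).exec s).reg = s.reg ∧
    (∀ B, B ≠ A → ((tabulate A e).exec s).arr B = s.arr B) ∧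
    ∀ u < s.reg 2, ∀ v < s.reg 2, ((tabulate A e).exec s).arr A (s.reg 2 * u + v) = f u v := by
  set n := s.reg 2 with hn
  have hinj : ∀ u v u' v', v < n → v' < n → n * u + v = n * u' + v' → u = u' ∧ v = v' := by
    intro u v u' v' hv hv' h
    have h1 : (n * u + v) / n = u := by
      rw [Nat.mul_add_div (by omega), Nat.div_eq_of_lt hv, add_zero]
    have h2 : (n * u' + v') / n = u' := by
      rw [Nat.mul_add_div (by omega), Nat.div_eq_of_lt hv', add_zero]
    rw [h, h2] at h1
    subst h1
    exact ⟨rfl, by omega⟩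
  have main := iterState_induction (x := 20) (s := s)
    (F := (Stmt.loop 21 2 (.store A (.add (.sum 30 2 (.var 20)) (.var 21)) e)).exec)
    (fun i s' => (∀ r, r ≠ 20 → s'.reg r = s.reg r) ∧ (∀ B, B ≠ A → s'.arr B = s.arr B) ∧
      ∀ u < i, ∀ v < n, s'.arr A (n * u + v) = f u v) n
    ⟨fun _ _ => rfl, fun _ _ => rfl, fun u hu => absurd hu (by omega)⟩ (by
      rintro i hi s₁ ⟨hr, hB, hA⟩
      have inner := iterState_induction (x := 21) (s := s₁.setReg 20 i)
        (F := (Stmt.store A (.add (.sum 30 2 (.var 20)) (.var 21)) e).exec)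
        (fun j s' => (∀ r, r ≠ 21 → s'.reg r = (s₁.setReg 20 i).reg r) ∧
          (∀ B, B ≠ A → s'.arr B = s.arr B) ∧
          (∀ u < i, ∀ v < n, s'.arr A (n * u + v) = f u v) ∧
          ∀ v < j, s'.arr A (n * i + v) = f i v) n
        ⟨fun _ _ => rfl, hB, hA, fun u hu => absurd hu (by omega)⟩ (by
          rintro j hj s₂ ⟨hr₂, hB₂, hA₂, hC₂⟩
          have e2 : (s₂.setReg 21 j).reg 2 = n := by
            rw [State.setReg_reg_of_ne _ _ (by omega), hr₂ _ (by omega),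
              State.setReg_reg_of_ne _ _ (by omega), hr _ (by omega)]
          have e20 : (s₂.setReg 21 j).reg 20 = i := by
            rw [State.setReg_reg_of_ne _ _ (by omega), hr₂ _ (by omega), State.setReg_reg_self]
          have hval : e.eval (s₂.setReg 21 j) = f i j := by
            rw [he (s₂.setReg 21 j) _ hB₂ (by rw [e20]; exact hi) (by rw [State.setReg_reg_self]; exact hj), e20,
              State.setReg_reg_self]
            intro r h20 h21
            rw [State.setReg_reg_of_ne _ _ h21, hr₂ _ h21, State.setReg_reg_of_ne _ _ h20,
              hr _ h20]
          have hidx : (Ex.add (.sum 30 2 (.var 20)) (.var 21)).eval (s₂.setReg 21 j) =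
              n * i + j := by
            simp only [Ex.eval, State.setReg_reg_of_ne _ _ (show 20 ≠ 30 by omega), e20, e2,
              State.setReg_reg_self, Finset.sum_const, Finset.card_range, smul_eq_mul]
          rw [Stmt.exec, hval, hidx]
          refine ⟨fun r h => ?_, fun B hne => ?_, fun u hu v hv => ?_, fun v hv => ?_⟩
          · rw [State.setArr_reg, State.setReg_reg_of_ne _ _ h, hr₂ _ h]
          · funext y
            rw [State.setArr_arr, if_neg (fun h => hne h.1), State.setReg_arr, hB₂ _ hne]
          · rw [State.setArr_arr, if_neg, State.setReg_arr, hA₂ u hu v hv]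
            rintro ⟨-, h⟩
            have := (hinj _ _ _ _ hv hj h).1
            omega
          · rw [State.setArr_arr]
            split_ifs with h
            · obtain rfl : v = j := by omega
              rfl
            · rw [State.setReg_arr]
              exact hC₂ v (by
                have : v ≠ j := fun hvj => h ⟨rfl, by rw [hvj]⟩
                omega))
      have e2 : (s₁.setReg 20 i).reg 2 = n := by
        rw [State.setReg_reg_of_ne _ _ (by omega), hr _ (by omega)]
      rw [Stmt.exec, e2]
      refine ⟨fun r h => ?_, inner.2.1, fun u hu v hv => ?_⟩
      · rw [State.setReg_reg]
        split_ifs with h21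
        · rw [h21, State.setReg_reg_of_ne _ _ (by omega), hr _ (by omega)]
        · rw [inner.1 _ h21, State.setReg_reg_of_ne _ _ h, hr _ h]
      · rw [State.setReg_arr]
        rcases Nat.lt_succ_iff_lt_or_eq.1 hu with h | h
        · exact inner.2.2.1 u h v hv
        · rw [h]
          exact inner.2.2.2 v hv)
  have hexec : (tabulate A e).exec s = (iterState 20 (Stmt.loop 21 2
    (.store A (.add (.sum 30 2 (.var 20)) (.var 21)) e)).exec s n).setReg 20 (s.reg 20) := rfl
  rw [hexec]
  refine ⟨?_, main.2.1, main.2.2⟩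
  funext r
  rw [State.setReg_reg]
  split_ifs with h
  · rw [h]
  · exact main.1 _ h

/-! ## Digits -/

/-- The quotient of register `10` by register `5`, provided that it is at most the content of
register `T`. -/
def Ex.quot (T : ℕ) : Ex := .sum 24 T ((Ex.sum 31 5 (.add (.var 24) (.const 1))).le (.var 10))

/-- The quotient is the number of `y` for which the divisor times `y + 1` does not exceed the
dividend, and all these `y` lie below the dividend. -/
theorem Ex.eval_quot {T : ℕ} {s : State} (hpos : 0 < s.reg 5) (hle : s.reg 10 ≤ s.reg T) :
    (Ex.quot T).eval s = s.reg 10 / s.reg 5 := by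
  have h1 : ∀ y, ((Ex.sum 31 5 (.add (.var 24) (.const 1))).le (.var 10)).eval (s.setReg 24 y) =
      if y < s.reg 10 / s.reg 5 then 1 else 0 := by
    intro y
    have h2 : y < s.reg 10 / s.reg 5 ↔ s.reg 5 * (y + 1) ≤ s.reg 10 := by
      rw [← Nat.succ_le_iff, Nat.le_div_iff_mul_le hpos, mul_comm]
    simp only [Ex.le, eval, State.setReg_reg, h2]
    norm_num
    split_ifs <;> omega
  rw [quot, eval, Finset.sum_congr rfl fun y _ => h1 y, ← Finset.card_filter]
  have h2 : (Finset.range (s.reg T)).filter (fun y => y < s.reg 10 / s.reg 5) =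
      Finset.range (s.reg 10 / s.reg 5) := by
    ext y
    have := Nat.div_le_self (s.reg 10) (s.reg 5)
    simp only [Finset.mem_filter, Finset.mem_range]
    omega
  rw [h2, Finset.card_range]

/-- Write the digits of register `10` to base register `5` into the cells of array `A` whose
index `v` satisfies `cond`, and `0` into all others. -/
def Stmt.digits (A : ℕ) (cond : Ex) (v N T : ℕ) : Stmt :=
  .loop v N (.seq
    (.store A (.var v) (.ite cond (.sub (.var 10) (.sum 31 5 (.quot T))) (.const 0)))
    (.assign 10 (.ite cond (.quot T) (.var 10))))

open Classical in
-- Invariant: before position `i`, register 10 holds the input divided by the base once for each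
-- selected position below `i`. The remainder is obtained by subtracting base times quotient.
theorem Stmt.exec_digits {A : ℕ} {cond : Ex} {v N T : ℕ} {p : ℕ → Prop} (s : State)
    (hv5 : v ≠ 5) (hv10 : v ≠ 10) (hvT : v ≠ T) (hT : T ≠ 10) (hT31 : T ≠ 31)
    (hpos : 0 < s.reg 5) (hle : s.reg 10 ≤ s.reg T)
    (hcond : ∀ s' : State, (∀ r, r ≠ v → r ≠ 10 → s'.reg r = s.reg r) →
      (∀ B, B ≠ A → s'.arr B = s.arr B) → s'.reg v < s.reg N → (cond.Holds s' ↔ p (s'.reg v))) :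
    (∀ r, r ≠ 10 → ((digits A cond v N T).exec s).reg r = s.reg r) ∧
    (∀ B, B ≠ A → ((digits A cond v N T).exec s).arr B = s.arr B) ∧
    ∀ i < s.reg N, ((digits A cond v N T).exec s).arr A i =
      if p i then s.reg 10 / s.reg 5 ^ (Nat.count p i) % s.reg 5 else 0 := by
  have main := iterState_induction (x := v) (s := s)
    (F := (Stmt.seq
      (.store A (.var v) (.ite cond (.sub (.var 10) (.sum 31 5 (.quot T))) (.const 0)))
      (.assign 10 (.ite cond (.quot T) (.var 10)))).exec)
    (fun i s' => (∀ r, r ≠ v → r ≠ 10 → s'.reg r = s.reg r) ∧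
      s'.reg 10 = s.reg 10 / s.reg 5 ^ (Nat.count p i) ∧
      (∀ B, B ≠ A → s'.arr B = s.arr B) ∧
      ∀ j < i, s'.arr A j =
        if p j then s.reg 10 / s.reg 5 ^ (Nat.count p j) % s.reg 5 else 0) (s.reg N)
    ⟨fun _ _ _ => rfl, by simp, fun _ _ => rfl, fun u hu => absurd hu (by omega)⟩ (by
      rintro i hi s₁ ⟨hr, hx, hB, hA⟩
      set s₂ := s₁.setReg v i with hs₂
      have hr₂ : ∀ r, r ≠ v → r ≠ 10 → s₂.reg r = s.reg r := fun r h h' => by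
        rw [hs₂, State.setReg_reg_of_ne _ _ h, hr _ h h']
      have hv₂ : s₂.reg v = i := by rw [hs₂, State.setReg_reg_self]
      have hx₂ : s₂.reg 10 = s.reg 10 / s.reg 5 ^ (Nat.count p i) := by
        rw [hs₂, State.setReg_reg_of_ne _ _ hv10.symm, hx]
      have h5 : s₂.reg 5 = s.reg 5 := hr₂ _ hv5.symm (by omega)
      have hle₂ : s₂.reg 10 ≤ s₂.reg T := by
        rw [hx₂, hr₂ T hvT.symm hT]
        exact (Nat.div_le_self _ _).trans hle
      set x := s.reg 10 / s.reg 5 ^ (Nat.count p i) with hxdef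
      have hc₂ : cond.Holds s₂ ↔ p i := by
        rw [hcond s₂ hr₂ hB (by rw [hv₂]; exact hi), hv₂]
      have hq : ∀ s' : State, (∀ r, r ≠ 31 → s'.reg r = s₂.reg r) →
          (Ex.quot T).eval s' = x / s.reg 5 := by
        intro s' h
        rw [Ex.eval_quot, h _ (by omega), h _ (by omega), h5, hx₂]
        · rwa [h _ (by omega), h5]
        · rwa [h _ (by omega), h _ hT31]
      have hd : (Ex.sub (.var 10) (.sum 31 5 (.quot T))).eval s₂ = x % s.reg 5 := by
        rw [Ex.eval, Ex.eval, Ex.eval, Finset.sum_congr rfl fun y _ => hq (s₂.setReg 31 y)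
          (fun r h => State.setReg_reg_of_ne _ _ h), Finset.sum_const, Finset.card_range,
          smul_eq_mul, h5, hx₂]
        have := Nat.div_add_mod x (s.reg 5)
        omega
      have hstore : (Ex.ite cond (.sub (.var 10) (.sum 31 5 (.quot T))) (.const 0)).eval s₂ =
          if p i then x % s.reg 5 else 0 := by
        rw [Ex.eval_ite_holds, hd]
        simp only [hc₂, Ex.eval]
      set s₃ := s₂.setArr A i (if p i then x % s.reg 5 else 0) with hs₃
      have hc₃ : cond.Holds s₃ ↔ p i := by
        rw [hcond s₃ (fun r h h' => hr₂ r h h') (fun B hne => ?_) (by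
          rw [hs₃, State.setArr_reg, hv₂]; exact hi), hs₃, State.setArr_reg, hv₂]
        funext y
        rw [hs₃, State.setArr_arr, if_neg (fun h => hne h.1), ← hB _ hne]
        rfl
      have hexec : (Stmt.seq
          (.store A (.var v) (.ite cond (.sub (.var 10) (.sum 31 5 (.quot T))) (.const 0)))
          (.assign 10 (.ite cond (.quot T) (.var 10)))).exec s₂ =
          s₃.setReg 10 (if p i then x / s.reg 5 else x) := by
        rw [Stmt.exec, Stmt.exec, Stmt.exec, hstore, Ex.eval, hv₂, ← hs₃, Ex.eval_ite_holds,
          hq s₃ (fun r _ => rfl), Ex.eval, hs₃, State.setArr_reg, hx₂]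
        simp only [← hs₃, hc₃]
      rw [hexec]
      refine ⟨fun r h h' => ?_, ?_, fun B hne => ?_, fun j hj => ?_⟩
      · rw [State.setReg_reg_of_ne _ _ h', hs₃, State.setArr_reg, hr₂ r h h']
      · rw [State.setReg_reg_self, Nat.count_succ]
        split_ifs with h
        · rw [hxdef, Nat.div_div_eq_div_mul, pow_succ]
        · rfl
      · funext y
        rw [State.setReg_arr, hs₃, State.setArr_arr, if_neg (fun h => hne h.1), ← hB _ hne]
        rfl
      · rw [State.setReg_arr, hs₃, State.setArr_arr]
        by_cases hji : j = i
        · rw [if_pos ⟨rfl, hji⟩, hji]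
        · rw [if_neg (fun h => hji h.2)]
          exact hA j (by omega))
  have hexec : (digits A cond v N T).exec s = (iterState v (Stmt.seq
      (.store A (.var v) (.ite cond (.sub (.var 10) (.sum 31 5 (.quot T))) (.const 0)))
      (.assign 10 (.ite cond (.quot T) (.var 10)))).exec s (s.reg N)).setReg v (s.reg v) := rfl
  rw [hexec]
  refine ⟨fun r h => ?_, main.2.2.1, main.2.2.2⟩
  rw [State.setReg_reg]
  split_ifs with h'
  · rw [h']
  · exact main.1 _ h' h

open Classical in
/-- Every choice of digits in the selected positions occurs. -/
theorem exists_digits (p : ℕ → Prop) {b : ℕ} (g : ℕ → ℕ) (hg : ∀ i, g i < b) (n : ℕ) :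
    ∃ c < b ^ (Nat.count p n), ∀ i < n, p i → c / b ^ (Nat.count p i) % b = g i := by
  have hb : 0 < b := (Nat.zero_le _).trans_lt (hg 0)
  induction n with
  | zero => exact ⟨0, by simp, fun i hi => absurd hi (by omega)⟩
  | succ n ih =>
    obtain ⟨c, hc, hci⟩ := ih
    by_cases hp : p n
    -- The position `n` becomes the new most significant digit; for an earlier selected position the
    -- added term is a multiple of the next higher power and does not affect its digit.
    · refine ⟨c + b ^ (Nat.count p n) * g n, ?_, fun i hi hpi => ?_⟩
      · rw [Nat.count_succ, if_pos hp, pow_succ]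
        have := Nat.mul_le_mul_left (b ^ (Nat.count p n)) (hg n)
        rw [Nat.mul_succ] at this
        omega
      · rcases Nat.lt_succ_iff_lt_or_eq.1 hi with h | h
        · rw [← hci i h hpi]
          have hlt : Nat.count p i + 1 ≤ Nat.count p n := by
            have h1 := Nat.count_monotone p (show i + 1 ≤ n from h)
            rwa [Nat.count_succ, if_pos hpi] at h1
          obtain ⟨m, hm⟩ := Nat.exists_eq_add_of_le hlt
          rw [hm, pow_add, pow_succ]
          rw [show c + b ^ (Nat.count p i) * b * b ^ m * g n =
            c + b ^ (Nat.count p i) * (b * (b ^ m * g n)) by ring,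
            Nat.add_mul_div_left _ _ (Nat.pow_pos hb), Nat.add_mul_mod_self_left]
        · rw [h, Nat.add_mul_div_left _ _ (Nat.pow_pos hb), Nat.div_eq_of_lt hc, zero_add,
            Nat.mod_eq_of_lt (hg n)]
    · refine ⟨c, by rwa [Nat.count_succ, if_neg hp, add_zero], fun i hi hpi => ?_⟩
      rcases Nat.lt_succ_iff_lt_or_eq.1 hi with h | h
      · exact hci i h hpi
      · exact absurd (h ▸ hpi) hp

end RAM

open RAM

namespace CGMinMax

/-! ### The program -/

/-- Register `u` and register `v` contain twins. -/
def twinEx (u v : ℕ) : Ex :=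
  ((Ex.var u).eq (.var v)).not.and (.all 22 2
    ((((Ex.cell 1 22 u).and ((Ex.var 22).eq (.var u)).not).iff
      ((Ex.cell 1 22 v).and ((Ex.var 22).eq (.var v)).not)).and
    (((Ex.cell 1 u 22).and ((Ex.var 22).eq (.var u)).not).iff
      ((Ex.cell 1 v 22).and ((Ex.var 22).eq (.var v)).not))))

/-- The item in register `u` precedes the item in register `v`. -/
def precedesEx (u v : ℕ) : Ex :=
  ((twinEx u v).and ((Ex.var u).lt (.var v))).or
    (((Ex.var u).eq (.var v)).not.and ((Ex.cell 1 u v).and (.all 22 2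
      ((Ex.cell 1 22 v).imp ((Ex.cell 1 22 u).or (Ex.cell 1 u 22))))))

/-- Register `21` contains a kernel item. -/
def kernelEx : Ex := (Ex.count 20 2 (precedesEx 20 21)).lt (.var 1)

/-- The item in register `21` is not dominated by the agent in register `23`. -/
def undominatedEx : Ex :=
  (Ex.sum 20 2 (((Ex.get 3 (.var 20)).eq (.add (.var 23) (.const 1))).and (Ex.cell 1 20 21))).not

/-- The demand of the agent in register `23`. -/
def demandEx : Ex :=
  .ite (.var 3) (.add (.count 21 2 undominatedEx) (.var 4))
    (.sub (.count 21 2 undominatedEx) (.var 4))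

/-- The condition of Hall's theorem for the set of agents in array `4`. -/
def hallEx : Ex :=
  (Ex.sum 23 1 (.ite (.get 4 (.var 23)) demandEx (.const 0))).le
    (.count 21 2 ((Ex.get 3 (.var 21)).not.and
      (.sum 23 1 ((Ex.get 4 (.var 23)).and undominatedEx))))

/-- Read the header of the input. -/
def headerStmt : Stmt :=
  .seq (.assign 1 (.get 0 (.const 0))) <|
  .seq (.assign 2 (.get 0 (.const 1))) <|
  .seq (.assign 3 (.get 0 (.const 2))) <|
  .seq (.assign 4 (.get 0 (.const 3))) <|
  .assign 5 (.add (.var 1) (.const 1))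

/-- Compute the reflexive transitive closure of the adjacency matrix in array `1`. -/
def closureStmt : Stmt :=
  .seq (.tabulate 1 (((Ex.var 20).eq (.var 21)).or
    (.get 0 (.add (.const 4) (.add (.sum 30 2 (.var 20)) (.var 21)))))) <|
  .loop 22 2 <|
    .seq (.tabulate 2 ((Ex.cell 1 20 21).or ((Ex.cell 1 20 22).and (Ex.cell 1 22 21))))
      (.tabulate 1 (.cell 2 20 21))

/-- Compute the numbers of ownership functions on the kernel and of digit sequences for the
agents in the registers `6` and `7`. -/
def countsStmt : Stmt :=
  .seq (.assign 6 (.const 1)) <|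
  .seq (.loop 21 2 (.assign 6 (.ite kernelEx (.sum 31 5 (.var 6)) (.var 6)))) <|
  .seq (.assign 7 (.const 1)) <|
  .loop 23 1 (.assign 7 (.sum 31 5 (.var 7)))

/-- Test Hall's condition for one set of agents. -/
def hallStmt : Stmt :=
  .seq (.assign 10 (.var 9)) <|
  .seq (.digits 4 (.const 1) 23 1 7) <|
  .assign 14 ((Ex.var 14).and hallEx)

/-- Test one ownership function. -/
def ownStmt : Stmt :=
  .seq (.assign 10 (.var 8)) <|
  .seq (.digits 3 kernelEx 21 2 6) <|
  .seq (.assign 14 (.const 1)) <|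
  .seq (.loop 9 7 hallStmt) <|
  .assign 0 ((Ex.var 0).or (.var 14))

/-- Test all ownership functions. -/
def searchStmt : Stmt :=
  .seq (.assign 0 (.const 0)) <|
  .seq (.loop 8 6 ownStmt) <|
  .assign 0 (.ite (.var 0) (.const 1) (.const 0))

/-! ### Correctness of the program -/

/-- The machine contains the parameters of the instance in the registers `1` to `5`. -/
structure Loaded (I : Instance) (s : State) : Prop where
  agents : s.reg 1 = I.numAgents
  items : s.reg 2 = I.numItems
  sign : s.reg 3 = if I.threshold < 0 then 1 else 0
  threshold : s.reg 4 = I.threshold.natAbs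
  base : s.reg 5 = I.numAgents + 1

/-- In addition, array `1` contains the domination matrix. -/
structure Ready (I : Instance) (s : State) : Prop extends Loaded I s where
  reach : ∀ u v : Fin I.numItems, s.arr 1 (I.numItems * u + v) ≠ 0 ↔ Dominates I.graph u v

theorem Loaded.congr {I : Instance} {s s' : State} (h : Loaded I s)
    (hr : ∀ r, 1 ≤ r → r ≤ 5 → s'.reg r = s.reg r) : Loaded I s' where
  agents := by rw [hr _ (by omega) (by omega), h.agents]
  items := by rw [hr _ (by omega) (by omega), h.items]
  sign := by rw [hr _ (by omega) (by omega), h.sign]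
  threshold := by rw [hr _ (by omega) (by omega), h.threshold]
  base := by rw [hr _ (by omega) (by omega), h.base]

theorem Ready.congr {I : Instance} {s s' : State} (h : Ready I s)
    (hr : ∀ r, 1 ≤ r → r ≤ 5 → s'.reg r = s.reg r) (hA : s'.arr 1 = s.arr 1) : Ready I s' where
  toLoaded := h.toLoaded.congr hr
  reach := by rw [hA]; exact h.reach

theorem Ready.setReg {I : Instance} {s : State} (h : Ready I s) {r : ℕ} (x : ℕ) (hr : 5 < r) :
    Ready I (s.setReg r x) :=
  h.congr (fun r' _ h5 => State.setReg_reg_of_ne _ _ (by omega)) rfl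

theorem Ready.holds_cell {I : Instance} {s : State} (h : Ready I s) {u v : ℕ}
    {a b : Fin I.numItems} (hu : u ≠ 30) (ha : s.reg u = a) (hb : s.reg v = b) :
    (Ex.cell 1 u v).Holds s ↔ Dominates I.graph a b := by
  rw [Ex.Holds, Ex.eval_cell _ _ _ _ hu, h.items, ha, hb, h.reach]

theorem Ready.holds_twinEx {I : Instance} {s : State} (h : Ready I s)
    {a b : Fin I.numItems} (ha : s.reg 20 = a) (hb : s.reg 21 = b) :
    (twinEx 20 21).Holds s ↔ IsTwin I.graph a b := by
  have h2 : ∀ (w : Fin I.numItems), ∀ s' : State, s' = s.setReg 22 w →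
      Ready I s' ∧ s'.reg 20 = a ∧ s'.reg 21 = b ∧ s'.reg 22 = w := by
    rintro w s' rfl
    exact ⟨h.setReg _ (by omega), by rw [State.setReg_reg_of_ne _ _ (by omega), ha],
      by rw [State.setReg_reg_of_ne _ _ (by omega), hb], State.setReg_reg_self _ _ _⟩
  simp only [twinEx, Ex.holds_and, Ex.holds_not, Ex.holds_eq, Ex.holds_all, Ex.eval, h.items, ha, hb,
    Ex.holds_iff, IsTwin, Fin.val_inj, ne_eq]
  refine and_congr_right fun _ => ⟨fun H w => ?_, fun H i hi => ?_⟩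
  · obtain ⟨hs, h20, h21, h22⟩ := h2 w _ rfl
    have := H w w.isLt
    simpa only [hs.holds_cell (by omega) h22 h20, hs.holds_cell (by omega) h22 h21,
      hs.holds_cell (by omega) h20 h22, hs.holds_cell (by omega) h21 h22, h20, h21, h22,
      Fin.val_inj] using this
  · obtain ⟨w, rfl⟩ : ∃ w : Fin I.numItems, (w : ℕ) = i := ⟨⟨i, hi⟩, rfl⟩
    obtain ⟨hs, h20, h21, h22⟩ := h2 w _ rfl
    have := H w
    simpa only [hs.holds_cell (by omega) h22 h20, hs.holds_cell (by omega) h22 h21,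
      hs.holds_cell (by omega) h20 h22, hs.holds_cell (by omega) h21 h22, h20, h21, h22,
      Fin.val_inj] using this

theorem Ready.holds_precedesEx {I : Instance} {s : State} (h : Ready I s)
    {a b : Fin I.numItems} (ha : s.reg 20 = a) (hb : s.reg 21 = b) :
    (precedesEx 20 21).Holds s ↔ Precedes I.graph a b := by
  have h2 : ∀ (w : Fin I.numItems), ∀ s' : State, s' = s.setReg 22 w →
      Ready I s' ∧ s'.reg 20 = a ∧ s'.reg 21 = b ∧ s'.reg 22 = w := by
    rintro w s' rfl
    exact ⟨h.setReg _ (by omega), by rw [State.setReg_reg_of_ne _ _ (by omega), ha],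
      by rw [State.setReg_reg_of_ne _ _ (by omega), hb], State.setReg_reg_self _ _ _⟩
  simp only [precedesEx, Ex.holds_or, Ex.holds_and, Ex.holds_not, Ex.holds_eq, Ex.holds_lt,
    Ex.holds_all, Ex.holds_imp, h.holds_twinEx ha hb, h.holds_cell (show 20 ≠ 30 by omega) ha hb,
    Ex.eval, h.items, ha, hb, Precedes, Fin.val_inj, ne_eq, Fin.lt_def]
  refine or_congr_right (and_congr_right fun _ => and_congr_right fun _ =>
    ⟨fun H w => ?_, fun H i hi => ?_⟩)
  · obtain ⟨hs, h20, h21, h22⟩ := h2 w _ rfl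
    have := H w w.isLt
    simpa only [hs.holds_cell (by omega) h22 h20, hs.holds_cell (by omega) h22 h21,
      hs.holds_cell (by omega) h20 h22] using this
  · obtain ⟨w, rfl⟩ : ∃ w : Fin I.numItems, (w : ℕ) = i := ⟨⟨i, hi⟩, rfl⟩
    obtain ⟨hs, h20, h21, h22⟩ := h2 w _ rfl
    have := H w
    simpa only [hs.holds_cell (by omega) h22 h20, hs.holds_cell (by omega) h22 h21,
      hs.holds_cell (by omega) h20 h22] using this

/-- Kernel items, as a predicate on the indices of items. -/
def Instance.Kernel (I : Instance) (v : ℕ) : Prop :=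
  ∃ h : v < I.numItems, IsKernelItem I.graph I.numAgents ⟨v, h⟩

theorem Ready.holds_kernelEx {I : Instance} {s : State} (h : Ready I s)
    (hb : s.reg 21 < I.numItems) : kernelEx.Holds s ↔ I.Kernel (s.reg 21) := by
  classical
  rw [kernelEx, Ex.holds_lt, Ex.eval_count_fin _ _ _ _ h.items, Ex.eval, h.agents,
    Instance.Kernel, exists_prop_of_true hb, IsKernelItem]
  refine Eq.to_iff (congrArg (· < I.numAgents) (congrArg Finset.card ?_))
  ext u
  rw [Finset.mem_filter_univ, Finset.mem_filter_univ]
  exact (h.setReg _ (by omega)).holds_precedesEx (State.setReg_reg_self _ _ _)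
    (by rw [State.setReg_reg_of_ne _ _ (by omega)])

/-- The ownership function in array `3`. -/
def ownOf (I : Instance) (s : State) : Fin I.numItems → ℕ := fun v => s.arr 3 v

theorem Ready.holds_undominatedEx {I : Instance} {s : State} (h : Ready I s)
    {v : Fin I.numItems} {i : ℕ} (hv : s.reg 21 = v) (hi : s.reg 23 = i) :
    undominatedEx.Holds s ↔ v ∈ undominated I.graph (ownedBy (ownOf I s) i) := by
  simp only [undominatedEx, Ex.holds_not, Ex.holds_sum, Ex.holds_and, Ex.holds_eq, Ex.eval,
    h.items, mem_undominated, ownedBy, ownOf, State.setReg_arr,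
    State.setReg_reg_self, State.setReg_reg_of_ne _ _ (show 23 ≠ 20 by omega), hi]
  have hcell : ∀ u : Fin I.numItems, (Ex.cell 1 20 21).Holds (s.setReg 20 u) ↔
      Dominates I.graph u v := fun u =>
    (h.setReg _ (by omega)).holds_cell (by omega) (State.setReg_reg_self _ _ _)
      (by rw [State.setReg_reg_of_ne _ _ (by omega), hv])
  constructor
  · intro H u hu hd
    exact H ⟨u, u.isLt, (Finset.mem_filter.1 hu).2, (hcell u).2 hd⟩
  · rintro H ⟨u, hu, hown, hd⟩
    exact H ⟨u, hu⟩ (Finset.mem_filter.2 ⟨Finset.mem_univ _, hown⟩) ((hcell ⟨u, hu⟩).1 hd)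

/-- Subtracting a negative threshold means adding its absolute value; otherwise truncated
subtraction agrees with `Int.toNat` of the difference. -/
theorem Ready.eval_demandEx {I : Instance} {s : State} (h : Ready I s) {i : ℕ}
    (hi : s.reg 23 = i) :
    demandEx.eval s = demand I.graph I.threshold (ownedBy (ownOf I s) i) := by
  classical
  have hcount : (Ex.count 21 2 undominatedEx).eval s =
      (undominated I.graph (ownedBy (ownOf I s) i)).card := by
    rw [Ex.eval_count_fin _ _ _ _ h.items]
    congr 1
    ext v
    rw [Finset.mem_filter_univ]
    exact (h.setReg _ (by omega)).holds_undominatedEx (State.setReg_reg_self _ _ _)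
      (by rw [State.setReg_reg_of_ne _ _ (by omega), hi])
  simp only [demandEx, Ex.eval, hcount, h.sign, h.threshold, demand]
  split_ifs <;> omega

/-- The set of agents in array `4`. -/
def agentsOf (I : Instance) (s : State) : Finset (Fin I.numAgents) :=
  Finset.univ.filter fun i => s.arr 4 i ≠ 0

/-- The condition of Hall's theorem for the ownership function `own` and a set of agents. -/
def HallCondition (I : Instance) (own : Fin I.numItems → ℕ) (B : Finset (Fin I.numAgents)) :
    Prop :=
  ∑ i ∈ B, demand I.graph I.threshold (ownedBy own i) ≤
    ((Finset.univ.filter fun v => own v = 0).filter fun v =>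
      ∃ i ∈ B, v ∈ undominated I.graph (ownedBy own i)).card

theorem Ready.holds_hallEx {I : Instance} {s : State} (h : Ready I s) :
    hallEx.Holds s ↔ HallCondition I (ownOf I s) (agentsOf I s) := by
  classical
  have hleft : (Ex.sum 23 1 (.ite (.get 4 (.var 23)) demandEx (.const 0))).eval s =
      ∑ i ∈ agentsOf I s, demand I.graph I.threshold (ownedBy (ownOf I s) i) := by
    rw [Ex.eval, h.agents, Finset.sum_range, agentsOf, Finset.sum_filter]
    refine Finset.sum_congr rfl fun i _ => ?_
    rw [Ex.eval, (h.setReg _ (by omega)).eval_demandEx (State.setReg_reg_self _ _ _), Ex.eval,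
      Ex.eval, Ex.eval, State.setReg_reg_self]
    rfl
  have hright : (Ex.count 21 2 ((Ex.get 3 (.var 21)).not.and
      (.sum 23 1 ((Ex.get 4 (.var 23)).and undominatedEx)))).eval s =
      ((Finset.univ.filter fun v => ownOf I s v = 0).filter fun v =>
      ∃ i ∈ agentsOf I s, v ∈ undominated I.graph (ownedBy (ownOf I s) i)).card := by
    rw [Ex.eval_count_fin _ _ _ _ h.items, Finset.filter_filter]
    congr 1
    ext v
    rw [Finset.mem_filter_univ, Finset.mem_filter_univ, Ex.holds_and, Ex.holds_not, Ex.holds_sum,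
      (h.setReg _ (by omega)).agents]
    refine and_congr ?_ ?_
    · rw [Ex.Holds, Ex.eval, Ex.eval, State.setReg_reg_self, not_not]
      rfl
    · have hund : ∀ i : Fin I.numAgents,
          undominatedEx.Holds ((s.setReg 21 v).setReg 23 i) ↔
          v ∈ undominated I.graph (ownedBy (ownOf I s) i) := fun i =>
        ((h.setReg _ (by omega)).setReg _ (by omega)).holds_undominatedEx
          (by rw [State.setReg_reg_of_ne _ _ (by omega), State.setReg_reg_self])
          (State.setReg_reg_self _ _ _)
      have hget : ∀ i : ℕ, (Ex.get 4 (.var 23)).Holds ((s.setReg 21 v).setReg 23 i) ↔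
          s.arr 4 i ≠ 0 := fun i => by
        rw [Ex.Holds, Ex.eval, Ex.eval, State.setReg_reg_self]
        rfl
      simp only [agentsOf, Finset.mem_filter_univ, Ex.holds_and, hget]
      constructor
      · rintro ⟨i, hi, h4, hu⟩
        exact ⟨⟨i, hi⟩, h4, (hund ⟨i, hi⟩).1 hu⟩
      · rintro ⟨i, h4, hu⟩
        exact ⟨i, i.isLt, h4, (hund i).2 hu⟩
  rw [hallEx, Ex.holds_le, hleft, hright, HallCondition]

/-! ### The effect of the parts of the program -/

theorem Instance.length_encode (I : Instance) :
    I.encode.length = 4 + I.numItems * I.numItems := by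
  simp [Instance.encode, List.length_flatMap]
  ring

/-- The offset 4 skips the header. The nested list is identified with a single list over `numItems *
numItems` positions, read by quotient and remainder. -/
theorem Instance.encode_getD (I : Instance) (u v : Fin I.numItems) :
    I.encode.getD (4 + (I.numItems * u + v)) 0 ≠ 0 ↔ I.graph.Adj u v := by
  classical
  have hlt : ∀ u v : Fin I.numItems, I.numItems * u + v < I.numItems * I.numItems := fun u v => by
    have h1 : I.numItems * (u + 1) ≤ I.numItems * I.numItems := Nat.mul_le_mul_left _ u.isLt
    have h2 := v.isLt
    rw [Nat.mul_succ] at h1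
    omega
  have hpos : 0 < I.numItems := u.pos
  have hflat : ((List.finRange I.numItems).flatMap fun u =>
      (List.finRange I.numItems).map fun v => if I.graph.Adj u v then 1 else 0) =
      List.ofFn fun x : Fin (I.numItems * I.numItems) =>
        if I.graph.Adj ⟨x / I.numItems, Nat.div_lt_of_lt_mul x.isLt⟩ ⟨x % I.numItems, Nat.mod_lt _ hpos⟩
        then 1 else 0 := by
    rw [List.ofFn_mul', List.flatMap, List.ofFn_eq_map]
    congr 1
    refine List.map_congr_left fun a _ => ?_
    rw [List.ofFn_eq_map]
    refine List.map_congr_left fun b _ => ?_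
    have h1 : (I.numItems * (a : ℕ) + b) / I.numItems = a := by
      rw [Nat.mul_add_div hpos, Nat.div_eq_of_lt b.isLt, add_zero]
    have h2 : (I.numItems * (a : ℕ) + b) % I.numItems = b := by
      rw [Nat.mul_add_mod, Nat.mod_eq_of_lt b.isLt]
    simp only [h1, h2]
  have h1 : (I.numItems * (u : ℕ) + v) / I.numItems = u := by
    rw [Nat.mul_add_div hpos, Nat.div_eq_of_lt v.isLt, add_zero]
  have h2 : (I.numItems * (u : ℕ) + v) % I.numItems = v := by
    rw [Nat.mul_add_mod, Nat.mod_eq_of_lt v.isLt]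
  rw [Instance.encode, List.getD_append_right _ _ _ _ (by simp), hflat]
  simp only [List.length_cons, List.length_nil, Nat.reduceAdd, Nat.add_sub_cancel_left]
  rw [List.getD_eq_getElem _ _ (by rw [List.length_ofFn]; exact hlt u v), List.getElem_ofFn]
  simp only [h1, h2, Fin.eta]
  simp

theorem loaded_headerStmt (I : Instance) :
    Loaded I (headerStmt.exec (State.init I.encode)) ∧
      (headerStmt.exec (State.init I.encode)).arr = (State.init I.encode).arr := by
  refine ⟨⟨?_, ?_, ?_, ?_, ?_⟩, rfl⟩ <;>
  simp [headerStmt, Stmt.exec, Ex.eval, State.setReg_reg, State.init, Instance.encode]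

/-! ### Warshall's algorithm -/

/-- Domination through intermediate items with index below `t`, as in Warshall's algorithm. -/
def WarshallRel {n : ℕ} (G : Digraph (Fin n)) : ℕ → Fin n → Fin n → Prop
  | 0, u, v => u = v ∨ G.Adj u v
  | t + 1, u, v => WarshallRel G t u v ∨
      ∃ w : Fin n, (w : ℕ) = t ∧ WarshallRel G t u w ∧ WarshallRel G t w v

theorem WarshallRel.dominates {n : ℕ} {G : Digraph (Fin n)} {t : ℕ} {u v : Fin n}
    (h : WarshallRel G t u v) : Dominates G u v := by
  induction t generalizing u v with
  | zero =>
    rcases h with rfl | h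
    · exact .refl
    · exact .single h
  | succ t ih =>
    rcases h with h | ⟨w, -, h, h'⟩
    · exact ih h
    · exact (ih h).trans (ih h')

/-- Induction on `t`. If both halves pass through the last pivot, the stretch between the two visits
is dropped; if `w` is itself the pivot, neither half needs it as an intermediate item. -/
theorem WarshallRel.trans {n : ℕ} {G : Digraph (Fin n)} {t : ℕ} {u w v : Fin n} (hw : (w : ℕ) < t)
    (h : WarshallRel G t u w) (h' : WarshallRel G t w v) : WarshallRel G t u v := by
  induction t generalizing u w v with
  | zero => omega
  | succ t ih =>
    rcases Nat.lt_succ_iff_lt_or_eq.1 hw with hlt | heq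
    · rcases h with h | ⟨x, hx, h1, h2⟩
      · rcases h' with h' | ⟨y, hy, h3, h4⟩
        · exact .inl (ih hlt h h')
        · exact .inr ⟨y, hy, ih hlt h h3, h4⟩
      · rcases h' with h' | ⟨y, hy, h3, h4⟩
        · exact .inr ⟨x, hx, h1, ih hlt h2 h'⟩
        · obtain rfl : x = y := Fin.ext (by omega)
          exact .inr ⟨x, hx, h1, h4⟩
    · have h1 : WarshallRel G t u w := by
        rcases h with h | ⟨x, hx, h1, -⟩
        · exact h
        · obtain rfl : x = w := Fin.ext (by omega)
          exact h1
      have h2 : WarshallRel G t w v := by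
        rcases h' with h' | ⟨x, hx, -, h3⟩
        · exact h'
        · obtain rfl : x = w := Fin.ext (by omega)
          exact h3
      exact .inr ⟨w, heq, h1, h2⟩

theorem warshallRel_iff {n : ℕ} {G : Digraph (Fin n)} {u v : Fin n} :
    WarshallRel G n u v ↔ Dominates G u v := by
  have hmono : ∀ t a b, WarshallRel G 0 a b → WarshallRel G t a b := by
    intro t a b h
    induction t with
    | zero => exact h
    | succ t ih => exact .inl ih
  refine ⟨fun h => h.dominates, fun h => ?_⟩
  induction h with
  | refl => exact hmono _ _ _ (.inl rfl)
  | tail _ hab ih => exact .trans (Fin.isLt _) ih (hmono _ _ _ (.inr hab))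

/-- Each pass writes the new matrix to array 2 and then copies it back, so all its entries are
computed from the old matrix and pass `t` realizes `WarshallRel` at `t + 1` exactly. -/
theorem ready_closureStmt {I : Instance} {s : State} (h : Loaded I s)
    (hA : s.arr = (State.init I.encode).arr) :
    Ready I (closureStmt.exec s) := by
  set n := I.numItems with hn
  obtain ⟨hr₁, -, hv₁⟩ := Stmt.exec_tabulate (A := 1)
    (e := ((Ex.var 20).eq (.var 21)).or
      (.get 0 (.add (.const 4) (.add (.sum 30 2 (.var 20)) (.var 21)))))
    (f := fun u v => if u = v then 1 else I.encode.getD (4 + (n * u + v)) 0) s (by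
      classical
      intro s' hr hB _ _
      have h2 : s'.reg 2 = n := by rw [hr _ (by omega) (by omega), h.items]
      rw [Ex.or, Ex.eval_ite_holds, Ex.holds_eq]
      simp only [Ex.eval, h2, State.setReg_reg_of_ne _ _ (show 20 ≠ 30 by omega),
        Finset.sum_const, Finset.card_range, smul_eq_mul, hB 0 (by omega), hA, State.init,
        if_true])
  rw [h.items] at hv₁
  rw [closureStmt, Stmt.exec]
  set s₁ := (Stmt.tabulate 1 (((Ex.var 20).eq (.var 21)).or
      (.get 0 (.add (.const 4) (.add (.sum 30 2 (.var 20)) (.var 21)))))).exec s with hs₁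
  have h₁ : Loaded I s₁ := h.congr fun r _ _ => by rw [hr₁]
  have main := iterState_induction (x := 22) (s := s₁)
    (F := (Stmt.seq (.tabulate 2 ((Ex.cell 1 20 21).or ((Ex.cell 1 20 22).and (Ex.cell 1 22 21))))
      (.tabulate 1 (.cell 2 20 21))).exec)
    (fun t s' => (∀ r, r ≠ 22 → s'.reg r = s₁.reg r) ∧
      ∀ u v : Fin n, s'.arr 1 (n * u + v) ≠ 0 ↔ WarshallRel I.graph t u v) n
    ⟨fun _ _ => rfl, fun u v => by
      rw [hv₁ u u.isLt v v.isLt, WarshallRel, Fin.ext_iff]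
      by_cases huv : (u : ℕ) = v
      · simp [huv]
      · rw [if_neg huv, I.encode_getD]
        simp [huv]⟩ (by
      rintro t ht s₂ ⟨hr₂, hv₂⟩
      set s₃ := s₂.setReg 22 t with hs₃
      have hn₃ : s₃.reg 2 = n := by
        rw [hs₃, State.setReg_reg_of_ne _ _ (by omega), hr₂ _ (by omega), h₁.items]
      obtain ⟨hr₄, hB₄, hv₄⟩ := Stmt.exec_tabulate (A := 2)
        (e := (Ex.cell 1 20 21).or ((Ex.cell 1 20 22).and (Ex.cell 1 22 21)))
        (f := fun u v => if s₃.arr 1 (n * u + v) ≠ 0 then 1 else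
          if s₃.arr 1 (n * u + t) ≠ 0 then s₃.arr 1 (n * t + v) else 0) s₃ (by
          intro s' hr hB _ _
          have h2 : s'.reg 2 = n := by rw [hr _ (by omega) (by omega), hn₃]
          have h22 : s'.reg 22 = t := by
            rw [hr _ (by omega) (by omega), hs₃, State.setReg_reg_self]
          simp only [Ex.or, Ex.and, Ex.eval, Ex.eval_cell _ _ _ s' (show 20 ≠ 30 by omega),
            Ex.eval_cell _ _ _ s' (show 22 ≠ 30 by omega), h2, h22, hB 1 (by omega)])
      set s₄ := (Stmt.tabulate 2
        ((Ex.cell 1 20 21).or ((Ex.cell 1 20 22).and (Ex.cell 1 22 21)))).exec s₃ with hs₄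
      obtain ⟨hr₅, -, hv₅⟩ := Stmt.exec_tabulate (A := 1) (e := .cell 2 20 21)
        (f := fun u v => s₄.arr 2 (n * u + v)) s₄ (by
          intro s' hr hB _ _
          rw [Ex.eval_cell _ _ _ _ (by omega), hr _ (by omega) (by omega), hr₄, hn₃,
            hB 2 (by omega)])
      rw [hn₃] at hv₄
      rw [hr₄, hn₃] at hv₅
      rw [Stmt.exec, ← hs₄]
      refine ⟨fun r h22 => ?_, fun u v => ?_⟩
      · rw [hr₅, hr₄, hs₃, State.setReg_reg_of_ne _ _ h22, hr₂ _ h22]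
      · rw [hv₅ u u.isLt v v.isLt, hv₄ u u.isLt v v.isLt, hs₃, State.setReg_arr, WarshallRel]
        have e1 := hv₂ u v
        have e2 := hv₂ u ⟨t, ht⟩
        have e3 := hv₂ ⟨t, ht⟩ v
        simp only at e2 e3
        have e4 : (∃ w : Fin n, (w : ℕ) = t ∧ WarshallRel I.graph t u w ∧
            WarshallRel I.graph t w v) ↔ WarshallRel I.graph t u ⟨t, ht⟩ ∧
            WarshallRel I.graph t ⟨t, ht⟩ v := by
          constructor
          · rintro ⟨w, hw, h'⟩
            obtain rfl : w = ⟨t, ht⟩ := Fin.ext hw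
            exact h'
          · exact fun h' => ⟨_, rfl, h'⟩
        rw [e4, ← e1, ← e2, ← e3]
        split_ifs with g1 g2 <;> simp [g1] <;> tauto)
  have hexec : (Stmt.loop 22 2 (Stmt.seq
      (.tabulate 2 ((Ex.cell 1 20 21).or ((Ex.cell 1 20 22).and (Ex.cell 1 22 21))))
      (.tabulate 1 (.cell 2 20 21)))).exec s₁ = (iterState 22 (Stmt.seq
      (.tabulate 2 ((Ex.cell 1 20 21).or ((Ex.cell 1 20 22).and (Ex.cell 1 22 21))))
      (.tabulate 1 (.cell 2 20 21))).exec s₁ n).setReg 22 (s₁.reg 22) := by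
    rw [Stmt.exec, h₁.items]
  rw [hexec]
  refine ⟨h₁.congr fun r _ h5 => ?_, fun u v => ?_⟩
  · rw [State.setReg_reg_of_ne _ _ (by omega), main.1 _ (by omega)]
  · rw [State.setReg_arr, main.2 u v, warshallRel_iff]

/-! ### Enumeration of ownership functions and sets of agents -/

open Classical in
/-- The machine also contains the numbers of ownership functions and of digit sequences. -/
structure Counted (I : Instance) (s : State) : Prop extends Ready I s where
  owners : s.reg 6 = (I.numAgents + 1) ^ Nat.count I.Kernel I.numItems
  subsets : s.reg 7 = (I.numAgents + 1) ^ I.numAgents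

theorem Counted.congr {I : Instance} {s s' : State} (h : Counted I s)
    (hr : ∀ r, 1 ≤ r → r ≤ 7 → s'.reg r = s.reg r) (hA : s'.arr 1 = s.arr 1) : Counted I s' where
  toReady := h.toReady.congr (fun r h1 h5 => hr r h1 (by omega)) hA
  owners := by rw [hr _ (by omega) (by omega), h.owners]
  subsets := by rw [hr _ (by omega) (by omega), h.subsets]

/-- Powers are built by repeated multiplication with `k + 1`, itself a bounded sum: once for each
kernel item in register 6, once for each agent in register 7. -/
theorem counted_countsStmt {I : Instance} {s : State} (h : Ready I s) :
    Counted I (countsStmt.exec s) := by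
  classical
  have h₁ : Ready I (s.setReg 6 1) := h.setReg _ (by omega)
  have m₁ := iterState_induction (x := 21) (s := s.setReg 6 1)
    (F := (Stmt.assign 6 (.ite kernelEx (.sum 31 5 (.var 6)) (.var 6))).exec)
    (fun t s' => Ready I s' ∧ s'.reg 6 = (I.numAgents + 1) ^ Nat.count I.Kernel t) I.numItems
    ⟨h₁, by simp⟩ (by
      rintro t ht s' ⟨hs', h6⟩
      have hk := (hs'.setReg (r := 21) t (by omega)).holds_kernelEx
        (by rw [State.setReg_reg_self]; exact ht)
      rw [State.setReg_reg_self] at hk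
      refine ⟨(hs'.setReg _ (by omega)).setReg _ (by omega), ?_⟩
      rw [Stmt.exec, State.setReg_reg_self, Ex.eval_ite_holds, Nat.count_succ]
      simp only [hk, Ex.eval, State.setReg_reg_of_ne _ _ (show 6 ≠ 31 by omega),
        State.setReg_reg_of_ne _ _ (show 6 ≠ 21 by omega),
        State.setReg_reg_of_ne _ _ (show 5 ≠ 21 by omega), h6, hs'.base, Finset.sum_const,
        Finset.card_range, smul_eq_mul]
      split_ifs
      · rw [pow_succ, mul_comm]
      · rfl)
  set s₂ := (Stmt.loop 21 2 (.assign 6 (.ite kernelEx (.sum 31 5 (.var 6)) (.var 6)))).exec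
    (s.setReg 6 1) with hs₂
  have e₂ : s₂ = (iterState 21
      (Stmt.assign 6 (.ite kernelEx (.sum 31 5 (.var 6)) (.var 6))).exec (s.setReg 6 1)
      I.numItems).setReg 21 ((s.setReg 6 1).reg 21) := by
    rw [hs₂, Stmt.exec, h₁.items]
  have h₂ : Ready I s₂ := by
    rw [e₂]
    exact m₁.1.setReg _ (by omega)
  have h6 : s₂.reg 6 = (I.numAgents + 1) ^ Nat.count I.Kernel I.numItems := by
    rw [e₂, State.setReg_reg_of_ne _ _ (by omega), m₁.2]
  have h₃ : Ready I (s₂.setReg 7 1) := h₂.setReg _ (by omega)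
  have m₂ := iterState_induction (x := 23) (s := s₂.setReg 7 1)
    (F := (Stmt.assign 7 (.sum 31 5 (.var 7))).exec)
    (fun t s' => Ready I s' ∧ s'.reg 6 = s₂.reg 6 ∧ s'.reg 7 = (I.numAgents + 1) ^ t) I.numAgents
    ⟨h₃, State.setReg_reg_of_ne _ _ (by omega), by simp⟩ (by
      rintro t ht s' ⟨hs', h6, h7⟩
      refine ⟨(hs'.setReg _ (by omega)).setReg _ (by omega), ?_, ?_⟩
      · rw [Stmt.exec, State.setReg_reg_of_ne _ _ (by omega),
          State.setReg_reg_of_ne _ _ (by omega), h6]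
      · rw [Stmt.exec, State.setReg_reg_self]
        simp only [Ex.eval, State.setReg_reg_of_ne _ _ (show 7 ≠ 31 by omega),
          State.setReg_reg_of_ne _ _ (show 7 ≠ 23 by omega),
          State.setReg_reg_of_ne _ _ (show 5 ≠ 23 by omega), h7, hs'.base, Finset.sum_const,
          Finset.card_range, smul_eq_mul]
        rw [pow_succ, mul_comm])
  have e₃ : countsStmt.exec s = (iterState 23 (Stmt.assign 7 (.sum 31 5 (.var 7))).exec
      (s₂.setReg 7 1) I.numAgents).setReg 23 ((s₂.setReg 7 1).reg 23) := by
    have : countsStmt.exec s =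
        (Stmt.loop 23 1 (.assign 7 (.sum 31 5 (.var 7)))).exec (s₂.setReg 7 1) := rfl
    rw [this, Stmt.exec, h₃.agents]
  rw [e₃]
  refine ⟨m₂.1.setReg _ (by omega), ?_, ?_⟩
  · rw [State.setReg_reg_of_ne _ _ (by omega), m₂.2.1, h6]
  · rw [State.setReg_reg_of_ne _ _ (by omega), m₂.2.2]

open Classical in
/-- The ownership function with number `c`. -/
noncomputable def Instance.ownDigits (I : Instance) (c : ℕ) : Fin I.numItems → ℕ := fun v =>
  if I.Kernel v then c / (I.numAgents + 1) ^ Nat.count I.Kernel v % (I.numAgents + 1) else 0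

/-- The set of agents with number `b`. -/
def Instance.agentDigits (I : Instance) (b : ℕ) : Finset (Fin I.numAgents) :=
  Finset.univ.filter fun i => b / (I.numAgents + 1) ^ (i : ℕ) % (I.numAgents + 1) ≠ 0

theorem exec_hallStmt {I : Instance} {s : State} (h : Counted I s)
    (h9 : s.reg 9 < (I.numAgents + 1) ^ I.numAgents) :
    (∀ r, r ≠ 10 → r ≠ 14 → (hallStmt.exec s).reg r = s.reg r) ∧
    (∀ B, B ≠ 4 → (hallStmt.exec s).arr B = s.arr B) ∧
    ((hallStmt.exec s).reg 14 ≠ 0 ↔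
      s.reg 14 ≠ 0 ∧ HallCondition I (ownOf I s) (I.agentDigits (s.reg 9))) := by
  classical
  set s₁ := s.setReg 10 (s.reg 9) with hs₁
  have h₁ : Counted I s₁ := h.congr (fun r _ _ => State.setReg_reg_of_ne _ _ (by omega)) rfl
  obtain ⟨hr, hB, hA⟩ := Stmt.exec_digits (A := 4) (cond := .const 1) (v := 23) (N := 1) (T := 7)
    (p := fun _ => True) s₁ (by omega) (by omega) (by omega) (by omega) (by omega)
    (by rw [h₁.base]; omega)
    (by rw [h₁.subsets, hs₁, State.setReg_reg_self]; exact h9.le) (by simp)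
  set s₂ := (Stmt.digits 4 (.const 1) 23 1 7).exec s₁ with hs₂
  have h₂ : Counted I s₂ := h₁.congr (fun r _ _ => hr _ (by omega)) (hB _ (by omega))
  have hexec : hallStmt.exec s = s₂.setReg 14 (((Ex.var 14).and hallEx).eval s₂) := rfl
  have hown : ownOf I s₂ = ownOf I s := by
    unfold ownOf
    rw [hB _ (by omega)]
    rfl
  have hag : agentsOf I s₂ = I.agentDigits (s.reg 9) := by
    ext i
    rw [agentsOf, Instance.agentDigits, Finset.mem_filter_univ, Finset.mem_filter_univ,
      hA i (by rw [h₁.agents]; exact i.isLt), if_pos trivial, h₁.base, hs₁,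
      State.setReg_reg_self, Nat.count_eq_card_filter_range]
    simp
  rw [hexec]
  refine ⟨fun r h10 h14 => ?_, fun B hne => ?_, ?_⟩
  · rw [State.setReg_reg_of_ne _ _ h14, hr _ h10, hs₁, State.setReg_reg_of_ne _ _ h10]
  · rw [State.setReg_arr, hB _ hne]
    rfl
  · rw [State.setReg_reg_self]
    change ((Ex.var 14).and hallEx).Holds s₂ ↔ _
    rw [Ex.holds_and, h₂.toReady.holds_hallEx, hown, hag, Ex.Holds, Ex.eval, hr _ (by omega), hs₁,
      State.setReg_reg_of_ne _ _ (by omega)]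

theorem exec_ownStmt {I : Instance} {s : State} (h : Counted I s) (h8 : s.reg 8 < s.reg 6) :
    Counted I (ownStmt.exec s) ∧ ((ownStmt.exec s).reg 0 ≠ 0 ↔ s.reg 0 ≠ 0 ∨
      ∀ b < (I.numAgents + 1) ^ I.numAgents,
        HallCondition I (I.ownDigits (s.reg 8)) (I.agentDigits b)) := by
  classical
  set s₁ := s.setReg 10 (s.reg 8) with hs₁
  have h₁ : Counted I s₁ := h.congr (fun r _ _ => State.setReg_reg_of_ne _ _ (by omega)) rfl
  obtain ⟨hr, hB, hA⟩ := Stmt.exec_digits (A := 3) (cond := kernelEx) (v := 21) (N := 2) (T := 6)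
    (p := I.Kernel) s₁ (by omega) (by omega) (by omega) (by omega) (by omega)
    (by rw [h₁.base]; omega)
    (by
      rw [hs₁, State.setReg_reg_self, State.setReg_reg_of_ne _ _ (by omega)]
      exact h8.le)
    -- Decoding writes only array 3, register 10 and its own index, so the domination matrix and the
    -- parameters behind the kernel test stay intact.
    (fun s' hr hB hlt => (h₁.toReady.congr (fun r _ _ => hr _ (by omega) (by omega))
      (hB _ (by omega))).holds_kernelEx (by rwa [h₁.items] at hlt))
  set s₂ := (Stmt.digits 3 kernelEx 21 2 6).exec s₁ with hs₂
  set s₃ := s₂.setReg 14 1 with hs₃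
  have h₃ : Counted I s₃ := h₁.congr
    (fun r _ _ => by rw [hs₃, State.setReg_reg_of_ne _ _ (by omega), hr _ (by omega)])
    (hB _ (by omega))
  have hown : ownOf I s₃ = I.ownDigits (s.reg 8) := by
    funext v
    rw [ownOf, hs₃, State.setReg_arr, hA v (by rw [h₁.items]; exact v.isLt), h₁.base, hs₁,
      State.setReg_reg_self, Instance.ownDigits]
  have main := iterState_induction (x := 9) (s := s₃) (F := hallStmt.exec)
    (fun t s' => Counted I s' ∧ s'.reg 0 = s.reg 0 ∧ s'.arr 3 = s₃.arr 3 ∧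
      (s'.reg 14 ≠ 0 ↔ ∀ b < t, HallCondition I (I.ownDigits (s.reg 8)) (I.agentDigits b)))
    ((I.numAgents + 1) ^ I.numAgents)
    ⟨h₃, by
      rw [hs₃, State.setReg_reg_of_ne _ _ (by omega), hr _ (by omega), hs₁,
        State.setReg_reg_of_ne _ _ (by omega)], rfl, by simp [hs₃]⟩ (by
      rintro t ht s' ⟨hs', h0, h3, h14⟩
      have hs'' : Counted I (s'.setReg 9 t) :=
        hs'.congr (fun r _ _ => State.setReg_reg_of_ne _ _ (by omega)) rfl
      obtain ⟨g1, g2, g3⟩ := exec_hallStmt hs'' (by rw [State.setReg_reg_self]; exact ht)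
      have hown' : ownOf I (s'.setReg 9 t) = I.ownDigits (s.reg 8) := by
        rw [← hown]
        unfold ownOf
        rw [State.setReg_arr, h3]
      refine ⟨hs''.congr (fun r _ _ => g1 _ (by omega) (by omega)) (g2 _ (by omega)), ?_, ?_, ?_⟩
      · rw [g1 _ (by omega) (by omega), State.setReg_reg_of_ne _ _ (by omega), h0]
      · rw [g2 _ (by omega), State.setReg_arr, h3]
      · rw [g3, State.setReg_reg_of_ne _ _ (by omega), h14, hown', State.setReg_reg_self,
          Nat.forall_lt_succ_right])
  set s₄ := (Stmt.loop 9 7 hallStmt).exec s₃ with hs₄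
  have e₄ : s₄ = (iterState 9 hallStmt.exec s₃ ((I.numAgents + 1) ^ I.numAgents)).setReg 9
      (s₃.reg 9) := by
    rw [hs₄, Stmt.exec, h₃.subsets]
  have hexec : ownStmt.exec s = s₄.setReg 0 (((Ex.var 0).or (.var 14)).eval s₄) := rfl
  rw [hexec]
  refine ⟨main.1.congr (fun r _ _ => ?_) ?_, ?_⟩
  · rw [State.setReg_reg_of_ne _ _ (by omega), e₄, State.setReg_reg_of_ne _ _ (by omega)]
  · rw [State.setReg_arr, e₄, State.setReg_arr]
  · rw [State.setReg_reg_self]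
    change ((Ex.var 0).or (.var 14)).Holds s₄ ↔ _
    rw [Ex.holds_or, Ex.Holds, Ex.Holds, Ex.eval, Ex.eval, e₄,
      State.setReg_reg_of_ne _ _ (by omega), State.setReg_reg_of_ne _ _ (by omega), main.2.1,
      main.2.2.2]

open Classical in
theorem exec_searchStmt {I : Instance} {s : State} (h : Counted I s) :
    (searchStmt.exec s).reg 0 = 1 ↔
      ∃ c < (I.numAgents + 1) ^ Nat.count I.Kernel I.numItems,
        ∀ b < (I.numAgents + 1) ^ I.numAgents,
          HallCondition I (I.ownDigits c) (I.agentDigits b) := by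
  have h₁ : Counted I (s.setReg 0 0) :=
    h.congr (fun r _ _ => State.setReg_reg_of_ne _ _ (by omega)) rfl
  have main := iterState_induction (x := 8) (s := s.setReg 0 0) (F := ownStmt.exec)
    (fun t s' => Counted I s' ∧ (s'.reg 0 ≠ 0 ↔ ∃ c < t,
      ∀ b < (I.numAgents + 1) ^ I.numAgents,
          HallCondition I (I.ownDigits c) (I.agentDigits b)))
    ((I.numAgents + 1) ^ Nat.count I.Kernel I.numItems)
    ⟨h₁, by simp⟩ (by
      rintro t ht s' ⟨hs', h0⟩
      have hs'' : Counted I (s'.setReg 8 t) :=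
        hs'.congr (fun r _ _ => State.setReg_reg_of_ne _ _ (by omega)) rfl
      obtain ⟨g1, g2⟩ := exec_ownStmt hs''
        (by rw [State.setReg_reg_self, hs''.owners]; exact ht)
      refine ⟨g1, ?_⟩
      rw [g2, State.setReg_reg_of_ne _ _ (by omega), State.setReg_reg_self, h0,
        Nat.exists_lt_succ_right])
  set s₂ := (Stmt.loop 8 6 ownStmt).exec (s.setReg 0 0) with hs₂
  have e₂ : s₂.reg 0 = (iterState 8 ownStmt.exec (s.setReg 0 0)
      ((I.numAgents + 1) ^ Nat.count I.Kernel I.numItems)).reg 0 := by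
    rw [hs₂, Stmt.exec, h₁.owners, State.setReg_reg_of_ne _ _ (by omega)]
  have hexec : (searchStmt.exec s).reg 0 = if s₂.reg 0 ≠ 0 then 1 else 0 := by
    have : searchStmt.exec s = s₂.setReg 0 ((Ex.ite (.var 0) (.const 1) (.const 0)).eval s₂) := rfl
    rw [this, State.setReg_reg_self]
    rfl
  rw [hexec, ← main.2, e₂]
  split_ifs with h' <;> simp [h']

open Classical in
-- Every number decodes to an admissible ownership function, and every admissible one occurs because
-- its values are at most `k` and vanish outside the kernel. Every set of agents occurs as well, so
-- testing all numbers `b` tests all Hall inequalities.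
theorem Instance.isYes_iff (I : Instance) : I.IsYes ↔
    ∃ c < (I.numAgents + 1) ^ Nat.count I.Kernel I.numItems,
      ∀ b < (I.numAgents + 1) ^ I.numAgents,
        HallCondition I (I.ownDigits c) (I.agentDigits b) := by
  rw [Instance.IsYes, exists_allocation_iff I.acyclic]
  constructor
  · rintro ⟨own, hle, hker, hB⟩
    obtain ⟨c, hc, hdig⟩ := exists_digits I.Kernel (b := I.numAgents + 1)
      (fun v => if hv : v < I.numItems then own ⟨v, hv⟩ else 0)
      (fun v => by split_ifs with hv <;> [exact Nat.lt_succ_of_le (hle _); omega]) I.numItems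
    have hown : I.ownDigits c = own := by
      funext v
      rw [Instance.ownDigits]
      split_ifs with hv
      · rw [hdig v v.isLt hv, dif_pos v.isLt]
      · rw [hker v fun hk => hv ⟨v.isLt, hk⟩]
    refine ⟨c, hc, fun b _ => ?_⟩
    rw [hown]
    unfold HallCondition
    convert hB (I.agentDigits b)
  · rintro ⟨c, -, H⟩
    refine ⟨I.ownDigits c, fun v => ?_, fun v hv => ?_, fun B => ?_⟩
    · rw [Instance.ownDigits]
      split_ifs
      · exact Nat.lt_succ_iff.1 (Nat.mod_lt _ (by omega))
      · omega
    · rw [Instance.ownDigits, if_neg]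
      rintro ⟨_, hk⟩
      exact hv hk
    -- Indicator values serve as digits to base `k + 1`. Binary would suffice, but this reuses the
    -- base of the ownership functions, and `(k + 1) ^ k` still depends on `k` alone.
    · obtain ⟨b, hb, hdig⟩ := exists_digits (fun _ => True) (b := I.numAgents + 1)
        (fun i => if hi : i < I.numAgents then (if (⟨i, hi⟩ : Fin I.numAgents) ∈ B then 1 else 0)
          else 0) (fun i => by split_ifs <;> omega) I.numAgents
      have hcount : ∀ i, @Nat.count (fun _ => True) (fun _ => Classical.propDecidable _) i = i :=
          fun i => by
        rw [Nat.count_eq_card_filter_range]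
        simp
      rw [hcount] at hb
      have hag : I.agentDigits b = B := by
        ext i
        have := hdig i i.isLt trivial
        rw [hcount, dif_pos i.isLt] at this
        rw [Instance.agentDigits, Finset.mem_filter_univ, this]
        simp
      have := H b hb
      rw [hag] at this
      unfold HallCondition at this
      convert this

/-! ### The running time -/

open Classical in
theorem count_kernel_le (I : Instance) :
    Nat.count I.Kernel I.numItems ≤ I.numAgents * pathIndepNumber I.graph := by
  refine le_trans (le_of_eq ?_) (card_kernel_le I.acyclic I.numAgents)
  rw [Nat.count_eq_card_filter_range, Finset.card_filter, Finset.card_filter, Finset.sum_range]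
  refine Finset.sum_congr rfl fun v _ => ?_
  simp only [Instance.Kernel, v.isLt, exists_true_left, Fin.eta]

theorem length_le_inputSize (w : List ℕ) : w.length ≤ inputSize w := by
  unfold inputSize
  induction w with
  | nil => simp
  | cons x w ih =>
    simp only [List.length_cons, List.map_cons, List.sum_cons]
    omega

theorem headerStmt_wellFormed : headerStmt.WellFormed := by
  repeat' first | exact trivial | decide | apply And.intro

theorem closureStmt_wellFormed : closureStmt.WellFormed := by
  repeat' first | exact trivial | decide | apply And.intro

theorem countsStmt_wellFormed : countsStmt.WellFormed := by
  repeat' first | exact trivial | decide | apply And.intro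

theorem searchStmt_wellFormed : searchStmt.WellFormed := by
  repeat' first | exact trivial | decide | apply And.intro

theorem computable_timeBound (D : ℕ) :
    Computable fun x : ℕ => (3 * (x + 1) ^ (x * x + x + 1)) ^ D := by
  have hpow : Primrec₂ ((· ^ ·) : ℕ → ℕ → ℕ) := Primrec₂.unpaired'.1 Nat.Primrec.pow
  have h1 : Primrec fun x : ℕ => x + 1 := Primrec.succ
  have h2 : Primrec fun x : ℕ => x * x + x + 1 :=
    Primrec.succ.comp (Primrec.nat_add.comp (Primrec.nat_mul.comp .id .id) .id)
  have h3 : Primrec fun x : ℕ => 3 * (x + 1) ^ (x * x + x + 1) :=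
    Primrec.nat_mul.comp (.const 3) (hpow.comp h1 h2)
  exact (hpow.comp h3 (.const D)).to_comp

end CGMinMax

open CGMinMax in
theorem mainTheorem6 :
    RAM.FixedParameterTractable CGMinMax.Instance.encode CGMinMax.Instance.IsYes
      CGMinMax.Instance.parameter := by
  classical
  obtain ⟨D₁, H₁⟩ := headerStmt.runs_compile headerStmt_wellFormed
  obtain ⟨D₂, H₂⟩ := closureStmt.runs_compile closureStmt_wellFormed
  obtain ⟨D₃, H₃⟩ := countsStmt.runs_compile countsStmt_wellFormed
  obtain ⟨D₄, H₄⟩ := searchStmt.runs_compile searchStmt_wellFormed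
  let D := max D₁ (max D₂ (max D₃ D₄ + 1) + 1) + 1
  refine ⟨.seq (headerStmt.compile 0) (.seq (closureStmt.compile 0) (.seq (countsStmt.compile 0)
    (searchStmt.compile 0))), _, D, computable_timeBound D, fun I => ?_⟩
  set κ := I.parameter with hκ
  set L := inputSize I.encode with hL
  -- The exponent covers the at most `k * d` kernel positions, the `k` agent digits, and 1 for the
  -- base itself; so `F * L` bounds all loop bounds.
  set F := (κ + 1) ^ (κ * κ + κ + 1) with hF
  have hk : I.numAgents ≤ κ := by
    rw [hκ, Instance.parameter]
    omega
  have hd : pathIndepNumber I.graph ≤ κ := by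
    rw [hκ, Instance.parameter]
    omega
  have hFpow : ∀ e, e ≤ κ * κ + κ + 1 → (I.numAgents + 1) ^ e ≤ F := fun e he =>
    (Nat.pow_le_pow_left (by omega) e).trans (Nat.pow_le_pow_right (by omega) he)
  have hlen : 4 + I.numItems * I.numItems ≤ L := by
    rw [← I.length_encode]
    exact length_le_inputSize _
  have hnL : I.numItems ≤ L := (Nat.le_mul_self _).trans (by omega)
  have hF1 : 1 ≤ F := Nat.one_le_pow _ _ (by omega)
  have hFM : F ≤ F * L := Nat.le_mul_of_pos_right _ (by omega)
  have hLM : L ≤ F * L := Nat.le_mul_of_pos_left _ (by omega)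
  have hk1 : I.numAgents + 1 ≤ F := by simpa using hFpow 1 (by omega)
  have bReady : ∀ s, Ready I s ∨ Loaded I s → ∀ r ∈ [1, 2, 5], s.reg r ≤ F * L := by
    intro s hs r hr
    have hs : Loaded I s := hs.elim (fun h => h.toLoaded) id
    simp only [List.mem_cons, List.not_mem_nil, or_false] at hr
    rcases hr with rfl | rfl | rfl
    · rw [hs.agents]; omega
    · rw [hs.items]; omega
    · rw [hs.base]; omega
  have bCounted : ∀ s, Counted I s → ∀ r ∈ [1, 2, 5, 6, 7], s.reg r ≤ F * L := by
    intro s hs r hr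
    simp only [List.mem_cons, List.not_mem_nil, or_false] at hr
    rcases hr with rfl | rfl | rfl | rfl | rfl
    · exact bReady s (.inr hs.toLoaded) 1 (by simp)
    · exact bReady s (.inr hs.toLoaded) 2 (by simp)
    · exact bReady s (.inr hs.toLoaded) 5 (by simp)
    · rw [hs.owners]
      refine (hFpow _ ?_).trans hFM
      have := (count_kernel_le I).trans (Nat.mul_le_mul hk hd)
      omega
    · rw [hs.subsets]
      exact (hFpow _ (by omega)).trans hFM
  -- Only register 0 is nonzero at the start, and doubling fixes 0, so the initial state represents
  -- itself.
  have hrep : Represents (State.init I.encode) (State.init I.encode) :=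
    ⟨fun r => by simp [State.init], rfl⟩
  obtain ⟨hl, harr⟩ := loaded_headerStmt I
  obtain ⟨t₁, n₁, hr₁, hrep₁, -, hn₁⟩ := H₁ 0 (F * L) _ _ hrep (by
    have : headerStmt.bounds = [] := rfl
    simp [this])
  have hready := ready_closureStmt hl harr
  obtain ⟨t₂, n₂, hr₂, hrep₂, -, hn₂⟩ := H₂ 0 (F * L) _ _ hrep₁ fun r hr =>
    bReady _ (.inr hl) r ((by decide : ∀ r ∈ closureStmt.bounds, r ∈ [1, 2, 5]) r hr)
  have hcounted := counted_countsStmt hready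
  obtain ⟨t₃, n₃, hr₃, hrep₃, -, hn₃⟩ := H₃ 0 (F * L) _ _ hrep₂ fun r hr =>
    bReady _ (.inl hready) r ((by decide : ∀ r ∈ countsStmt.bounds, r ∈ [1, 2, 5]) r hr)
  obtain ⟨t₄, n₄, hr₄, hrep₄, -, hn₄⟩ := H₄ 0 (F * L) _ _ hrep₃ fun r hr =>
    bCounted _ hcounted r ((by decide : ∀ r ∈ searchStmt.bounds, r ∈ [1, 2, 5, 6, 7]) r hr)
  refine ⟨t₄, _, .seq hr₁ (.seq hr₂ (.seq hr₃ hr₄)), ?_, ?_⟩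
  -- As `F * L` is at least 1, the base `F * L + 2` is at most `3 * F * L`, which separates the
  -- parameter from the input size.
  · refine (add_le_pow_max_succ hn₁ (add_le_pow_max_succ hn₂
      (add_le_pow_max_succ hn₃ hn₄))).trans ?_
    rw [← mul_pow, mul_assoc]
    exact Nat.pow_le_pow_left (by omega) _
  · have h0 : t₄.reg 0 = _ := hrep₄.1 0
    rw [h0, exec_searchStmt hcounted, I.isYes_iff]
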